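/- Let $n\ge 1$, let $n-1<s\le n$, let $H^s$ denote $s$-dimensional Hausdorff measure on $\mathbb{R}^n$, and let $Q(x,r)=\{y\in\mathbb{R}^n:\ |y_i-x_i|\le r,\ i=1,\dots,n\}$. Let $S\subset\mathbb{R}^n$ be an $s$-set (Ahlfors $s$-regular set): there are constants $c_1,c_2>0$ such that $c_1r^s\le H^s(Q(x,r)\cap S)\le c_2r^s$ for all $x\in S$ and $r>0$ with $\operatorname{diam}Q(x,r)\le\operatorname{diam}S$. Write $L^p(S)=L^p(S,H^s)$ with norm $\|\cdot\|_p$, and let $P_d$ be the set of real polynomials on $\mathbb{R}^n$ of degree at most $d$. Let $1<p\le\infty$ and let $\alpha>0$ be a non-integer. **Calderón type space.** With $k=\lceil\alpha\rceil$ and with $\frac{1}{H^s(Q\cap S)}\int_{Q\cap S}$ read as $0$ if $H^s(Q\cap S)=0$, put $$f^\sharp_{\alpha,S}(x)=\sup_{t>0}\ t^{-\alpha}\inf_{P\in P_{k-1}}\frac{1}{H^s(Q(x,t)\cap S)}\int_{Q(x,t)\cap S}|f-P|\,dH^s ,$$ $$C^p_\alpha(S)=\{f\in L^p(S):\ \|f\|_{C^p_\alpha(S)}=\|f\|_p+\|f^\sharp_{\alpha,S}\|_p<\infty\}.$$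 **Besov spaces.** A net $\pi$ with mesh size $r>0$ is a division of $\mathbb{R}^n$ into half-open cubes $\prod_{i}[a_i+rm_i,\,a_i+r(m_i+1))$, $m\in\mathbb{Z}^n$, for some $a\in\mathbb{R}^n$, and $P_d(\pi)$ is the set of functions that coincide on each cube of $\pi$ with a polynomial of degree at most $d$. For $1\le q\le\infty$, call a sequence $c=(c_\nu)_{\nu\ge0}$ of non-negative reals admissible for $f$ if for every $\nu\ge 0$ and every net $\pi$ with mesh size $2^{-\nu}$ there is $g\in P_{[\alpha]}(\pi)$ with $\|f-g\|_p\le 2^{-\nu\alpha}c_\nu$. Then $B^{p,q}_\alpha(S)$ is the set of $f\in L^p(S)$ that have an admissible sequence in $\ell^q$, with $\|f\|_{B^{p,q}_\alpha(S)}=\|f\|_p+\inf\{\|c\|_{\ell^q}:\ c\text{ admissible for }f\}$. **Theorem.** One has $$B^{p,p}_\alpha(S)\subset C^p_\alpha(S)\subset B^{p,\infty}_\alpha(S),$$ and both embeddings are continuous: there is a constant $C$, which depends only on $n$, $s$, $S$, $p$ and $\alpha$, such that $\|f\|_{C^p_\alpha(S)}\le C\|f\|_{B^{p,p}_\alpha(S)}$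 for all $f\in B^{p,p}_\alpha(S)$ and $\|f\|_{B^{p,\infty}_\alpha(S)}\le C\|f\|_{C^p_\alpha(S)}$ for all $f\in C^p_\alpha(S)$. -/

import Mathlib

open MeasureTheory Set
open scoped ENNReal NNReal

namespace SSet

/-- `ℝⁿ` with its Euclidean metric. -/
abbrev Rn (n : ℕ) : Type := EuclideanSpace ℝ (Fin n)

/-- The closed cube `Q(x, r)` with centre `x`, side length `2r` and sides parallel to the axes. -/
def cube {n : ℕ} (x : Rn n) (r : ℝ) : Set (Rn n) :=
  {y | ∀ i, |y i - x i| ≤ r}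

/-- `S` is an `s`-set (Ahlfors `s`-regular):  `c₁ r ^ s ≤ H^s(Q(x, r) ∩ S) ≤ c₂ r ^ s` for all
cubes centred on `S` with `diam Q ≤ diam S` (Euclidean, possibly infinite, diameters). -/
def IsSSet {n : ℕ} (s : ℝ) (S : Set (Rn n)) : Prop :=
  ∃ c₁ c₂ : ℝ, 0 < c₁ ∧ 0 < c₂ ∧ ∀ x ∈ S, ∀ r : ℝ, 0 < r →
    Metric.ediam (cube x r) ≤ Metric.ediam S →
      ENNReal.ofReal (c₁ * r ^ s) ≤ μH[s] (cube x r ∩ S) ∧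
      μH[s] (cube x r ∩ S) ≤ ENNReal.ofReal (c₂ * r ^ s)

/-- The measure `H^s` on `S`. Functions on `S` are represented by functions on `ℝⁿ`; only their
class modulo this measure matters, so `L^p(S)` is `L^p` of this measure. -/
noncomputable def measureOn {n : ℕ} (s : ℝ) (S : Set (Rn n)) : Measure (Rn n) :=
  (μH[s] : Measure (Rn n)).restrict S

/-- The value at `x ∈ ℝⁿ` of a real polynomial in `n` variables. -/
noncomputable def polyEval {n : ℕ} (P : MvPolynomial (Fin n) ℝ) (x : Rn n) : ℝ :=
  MvPolynomial.eval (fun i => x i) P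

/-- The normalized local best approximation of `f` on `Q` in `L^1(S)`:  the infimum of the averages
of `|f - P|` over `Q ∩ S` with respect to `H^s`, over all polynomials `P` of degree at most `k - 1`
(only `P = 0` if `k = 0`). -/
noncomputable def localApprox {n : ℕ} (s : ℝ) (S : Set (Rn n)) (k : ℕ) (f : Rn n → ℝ)
    (Q : Set (Rn n)) : ℝ≥0∞ :=
  ⨅ (P : MvPolynomial (Fin n) ℝ) (_ : P = 0 ∨ P.totalDegree < k),
    ⨍⁻ y in Q, ‖f y - polyEval P y‖ₑ ∂(measureOn s S)

/-- The fractional sharp maximal function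
`f^♯_{α,S}(x) = sup_{t > 0} t ^ (-α) 𝓔_k(f, Q(x, t))_{L^1(S)}`, where `k = ⌈α⌉ = -[-α]`. -/
noncomputable def sharpMaximal {n : ℕ} (s : ℝ) (S : Set (Rn n)) (α : ℝ) (f : Rn n → ℝ)
    (x : Rn n) : ℝ≥0∞ :=
  ⨆ (t : ℝ) (_ : 0 < t), ENNReal.ofReal (t ^ (-α)) * localApprox s S ⌈α⌉₊ f (cube x t)

/-- The norm `‖f‖_p + ‖f^♯_{α,S}‖_p` of the Calderón type space. -/
noncomputable def calderonNorm {n : ℕ} (s : ℝ) (S : Set (Rn n)) (α : ℝ) (p : ℝ≥0∞)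
    (f : Rn n → ℝ) : ℝ≥0∞ :=
  eLpNorm f p (measureOn s S) + eLpNorm (sharpMaximal s S α f) p (measureOn s S)

/-- The Calderón type space `C^p_α(S)`. -/
def CalderonSpace {n : ℕ} (s : ℝ) (S : Set (Rn n)) (α : ℝ) (p : ℝ≥0∞) : Set (Rn n → ℝ) :=
  {f | MemLp f p (measureOn s S) ∧ calderonNorm s S α p f < ∞}

/-- The half-open cube with index `m` of the net with mesh size `r` and base point `a`. As `m` runs
over `ℤⁿ` these cubes are a division of `ℝⁿ` by hyperplanes orthogonal to the axes, and
every net of mesh size `r` arises from some `a`. -/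
def netCube {n : ℕ} (a : Rn n) (r : ℝ) (m : Fin n → ℤ) : Set (Rn n) :=
  {y | ∀ i, a i + r * m i ≤ y i ∧ y i < a i + r * (m i + 1)}

/-- `g ∈ P_d(π)` for the net `π` with mesh size `r` and base point `a`:  on each cube of the net,
`g` is a polynomial of degree at most `d`. -/
def IsPiecewisePoly {n : ℕ} (d : ℕ) (a : Rn n) (r : ℝ) (g : Rn n → ℝ) : Prop :=
  ∀ m : Fin n → ℤ, ∃ P : MvPolynomial (Fin n) ℝ, P.totalDegree ≤ d ∧
    ∀ y ∈ netCube a r m, g y = polyEval P y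

/-- For every net `π` with mesh size `2 ^ (-ν)`, `ν = 0, 1, …`, there is `g ∈ P_{[α]}(π)` with
`‖f - g‖_{L^p(S)} ≤ 2 ^ (-να) c_ν`. -/
def IsBesovSequence {n : ℕ} (s : ℝ) (S : Set (Rn n)) (α : ℝ) (p : ℝ≥0∞) (f : Rn n → ℝ)
    (c : ℕ → ℝ≥0) : Prop :=
  ∀ (ν : ℕ) (a : Rn n), ∃ g : Rn n → ℝ,
    IsPiecewisePoly ⌊α⌋₊ a ((2 : ℝ) ^ (-(ν : ℝ))) g ∧
    eLpNorm (fun y => f y - g y) p (measureOn s S) ≤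
      ENNReal.ofReal ((2 : ℝ) ^ (-(ν * α))) * c ν

/-- The norm of a sequence in `ℓ^q`:  `(∑ c_ν ^ q) ^ (1 / q)`, and `sup c_ν` if `q = ∞`. -/
noncomputable def lqNorm (q : ℝ≥0∞) (c : ℕ → ℝ≥0) : ℝ≥0∞ :=
  eLpNorm (fun ν => (c ν : ℝ)) q Measure.count

/-- The Besov space `B^{p,q}_α(S)` (for `s`-sets with `n - 1 < s ≤ n`), `1 ≤ p, q ≤ ∞`. -/
def BesovSpace {n : ℕ} (s : ℝ) (S : Set (Rn n)) (α : ℝ) (p q : ℝ≥0∞) : Set (Rn n → ℝ) :=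
  {f | MemLp f p (measureOn s S) ∧
    ∃ c : ℕ → ℝ≥0, lqNorm q c < ∞ ∧ IsBesovSequence s S α p f c}

/-- The norm of `B^{p,q}_α(S)`:  `‖f‖_p` plus the infimum of `‖c‖_{ℓ^q}` over all sequences `c`
that are admissible in the definition of the space. -/
noncomputable def besovNorm {n : ℕ} (s : ℝ) (S : Set (Rn n)) (α : ℝ) (p q : ℝ≥0∞)
    (f : Rn n → ℝ) : ℝ≥0∞ :=
  eLpNorm f p (measureOn s S) +
    ⨅ (c : ℕ → ℝ≥0) (_ : IsBesovSequence s S α p f c), lqNorm q c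

end SSet

/-!
Let `μ` be the restriction of `H^s` to `S`. It is carried by the closure of `S`, where it is
two-sided `s`-regular on cubes of bounded size and doubling on all cubes (`IsRegular`). Nothing else
about `S` is used.

**From the Calderón type space to `B^{p,∞}`.** Since `s > n - 1`, the zero set of a nonzero polynomial
is `H^s`-null (`hausdorffMeasure_zeros`): its regular part is locally a bi-Lipschitz image of a subset
of `ℝⁿ⁻¹`, and its singular part lies in the zero set of a nonzero partial derivative. By a covering of
the zero set and compactness of the unit sphere in the space of polynomials, it follows that on every
cube centred on the support the supremum of a polynomial of bounded degree is bounded by its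
`μ`-average, uniformly over the cubes (`IsRegular.exists_polynomial_le_average`). With this inequality,
best approximations `P_j` of `f` on the cubes `Q(x, 2 ^ (-j) t)` satisfy
`|P_{j+1}(x) - P_j(x)| ≤ C (2 ^ (-j) t) ^ α f^♯(x)`, and they converge to `f(x)` at Lebesgue points, so
that `|f(x) - P_0(x)| ≤ C t ^ α f^♯(x)` (`IsRegular.exists_pointwise_bound`). On each cube of a net of
mesh size `r` one takes the best approximation on a comparable cube centred on the support, which is
close to the best approximation on `Q(x, 3 r)` for every `x` of the net cube. The error is then
pointwise at most `C r ^ α f^♯` (`IsRegular.exists_piecewisePoly`), and a constant sequence is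
admissible.

**From `B^{p,p}` to the Calderón type space.** A cube `Q(x, h)` is contained in a cube of one of `2 ^ n`
shifted nets of mesh size `4 h`, so that the local approximation of `f` on `Q(x, h)` is at most the sum
of the averages over `Q(x, h)` of `|f - g|` over the functions `g` belonging to these nets. Averaging
over cubes of a fixed size is bounded on `L^p` (`IsRegular.eLpNorm_setLAverage_le`), hence the part of
`f^♯` from the dyadic scale `2 ^ (-ν)` has `L^p` norm at most a constant times a term of the admissible
sequence, and the supremum over `ν` is estimated in `ℓ^p` (`eLpNorm_iSup_le`). Scales above `1 / 4`
contribute a geometric series of averages of `|f|`.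
-/

namespace SSet

open Filter Topology

/-! ### Zero sets of polynomials -/

theorem polyEval_zero {n : ℕ} (x : Rn n) : polyEval 0 x = 0 := by simp [polyEval]

theorem polyEval_sub {n : ℕ} (P Q : MvPolynomial (Fin n) ℝ) (x : Rn n) :
    polyEval (P - Q) x = polyEval P x - polyEval Q x := by simp [polyEval]

theorem hasStrictFDerivAt_polyEval {n : ℕ} (P : MvPolynomial (Fin n) ℝ) (x : Rn n) :
    HasStrictFDerivAt (polyEval P)
      (∑ i, polyEval (MvPolynomial.pderiv i P) x • EuclideanSpace.proj (𝕜 := ℝ) i) x := by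
  classical
  induction P using MvPolynomial.induction_on with
  | C a =>
    have : polyEval (MvPolynomial.C a : MvPolynomial (Fin n) ℝ) = fun _ => a := by
      funext y; simp [polyEval]
    simpa [this, polyEval_zero] using hasStrictFDerivAt_const (𝕜 := ℝ) a x
  | add p q hp hq =>
    have : polyEval (p + q) = polyEval p + polyEval q := by
      funext y; simp [polyEval]
    rw [this]
    refine (hp.add hq).congr_fderiv ?_
    rw [← Finset.sum_add_distrib]
    refine Finset.sum_congr rfl fun i _ => ?_
    rw [← add_smul]
    simp [polyEval]
  | mul_X p j hp =>
    have : polyEval (p * MvPolynomial.X j) = fun y => polyEval p y * y j := by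
      funext y; simp [polyEval]
    rw [this]
    have hj : HasStrictFDerivAt (fun y : Rn n => y j) (EuclideanSpace.proj (𝕜 := ℝ) j) x :=
      (EuclideanSpace.proj (𝕜 := ℝ) j : Rn n →L[ℝ] ℝ).hasStrictFDerivAt
    refine (hp.mul hj).congr_fderiv ?_
    have h1 : ∀ i, polyEval (MvPolynomial.pderiv i (p * MvPolynomial.X j)) x =
        polyEval (MvPolynomial.pderiv i p) x * x j + polyEval p x * (Pi.single i 1 : Fin n → ℝ) j := by
      intro i
      rw [MvPolynomial.pderiv_mul, MvPolynomial.pderiv_X]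
      by_cases h : j = i
      · subst h; simp [polyEval, add_comm]
      · simp [polyEval, h, mul_comm]
    simp only [h1, add_smul, Finset.sum_add_distrib, Finset.smul_sum, smul_smul]
    have h2 : ∑ i, (polyEval p x * (Pi.single i 1 : Fin n → ℝ) j) •
        (EuclideanSpace.proj (𝕜 := ℝ) i : Rn n →L[ℝ] ℝ) =
        polyEval p x • EuclideanSpace.proj (𝕜 := ℝ) j := by
      rw [Finset.sum_eq_single j (fun i _ hi => by simp [hi.symm]) (by simp)]
      simp
    rw [h2, add_comm]
    simp only [mul_comm]

theorem continuous_polyEval {n : ℕ} (P : MvPolynomial (Fin n) ℝ) : Continuous (polyEval P) :=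
  continuous_iff_continuousAt.2 fun x => (hasStrictFDerivAt_polyEval P x).continuousAt

/-- A non-constant polynomial has a nonzero partial derivative. -/
theorem exists_pderiv_ne_zero {n : ℕ} {P : MvPolynomial (Fin n) ℝ} (h : P.totalDegree ≠ 0) :
    ∃ i, MvPolynomial.pderiv i P ≠ 0 := by
  classical
  by_contra! hall
  apply h
  rw [MvPolynomial.totalDegree_eq_zero_iff]
  intro m hm i
  by_contra hmi
  have h1 := MvPolynomial.coeff_pderiv P (i := i) (m - Finsupp.single i 1)
  have h2 : m - Finsupp.single i 1 + Finsupp.single i 1 = m := by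
    apply tsub_add_cancel_of_le
    rw [Finsupp.single_le_iff]; omega
  rw [hall i, h2] at h1
  simp only [MvPolynomial.coeff_zero] at h1
  have h3 : MvPolynomial.coeff m P ≠ 0 := by simpa using hm
  have h4 : ((((m - Finsupp.single i 1 : Fin n →₀ ℕ) i : ℕ) : ℝ) + 1 ≠ 0) := by positivity
  exact mul_ne_zero h3 (by exact_mod_cast h4) h1.symm

theorem totalDegree_pderiv_le {n d : ℕ} {P : MvPolynomial (Fin n) ℝ}
    (h : P.totalDegree ≤ d + 1) (i : Fin n) : (MvPolynomial.pderiv i P).totalDegree ≤ d := by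
  classical
  rw [MvPolynomial.totalDegree]
  refine Finset.sup_le fun m hm => ?_
  have h1 : m + Finsupp.single i 1 ∈ P.support := by
    rw [MvPolynomial.mem_support_iff] at hm ⊢
    rw [MvPolynomial.coeff_pderiv] at hm
    exact left_ne_zero_of_mul hm
  have h2 := MvPolynomial.le_totalDegree h1
  rw [Finsupp.sum_add_index' (by simp) (by simp)] at h2
  simp at h2
  omega

/-- Near a point where `∂ᵢP ≠ 0`, the zero set of `P` is mapped injectively, with Lipschitz inverse,
onto a subset of `ℝⁿ⁻¹` by forgetting the `i`-th coordinate. -/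
theorem dimH_regular_zeros_le {n : ℕ} (P : MvPolynomial (Fin n) ℝ) (i : Fin n) :
    dimH {x : Rn n | polyEval P x = 0 ∧ polyEval (MvPolynomial.pderiv i P) x ≠ 0}
      ≤ ((n - 1 : ℕ) : ℝ≥0∞) := by
  classical
  by_contra! hlt
  obtain ⟨x, hx, hdim⟩ := exists_mem_nhdsWithin_lt_dimH_of_lt_dimH hlt
  set s := {x : Rn n | polyEval P x = 0 ∧ polyEval (MvPolynomial.pderiv i P) x ≠ 0} with hs
  have hstrict := hasStrictFDerivAt_polyEval P x
  set L : Rn n →L[ℝ] ℝ :=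
    ∑ i, polyEval (MvPolynomial.pderiv i P) x • EuclideanSpace.proj (𝕜 := ℝ) i with hL
  have hLapp : ∀ v : Rn n, L v = ∑ j, polyEval (MvPolynomial.pderiv j P) x * v j := by
    intro v; simp [hL]
  let proj : Rn n →L[ℝ] ({j : Fin n // j ≠ i} → ℝ) :=
    ContinuousLinearMap.pi fun j => EuclideanSpace.proj (𝕜 := ℝ) j.1
  have hinj : LinearMap.ker (L.prod proj : Rn n →ₗ[ℝ] ℝ × ({j : Fin n // j ≠ i} → ℝ)) = ⊥ := by
    rw [LinearMap.ker_eq_bot']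
    intro v hv
    have hv1 : L v = 0 := congrArg Prod.fst hv
    have hv2 : ∀ j, j ≠ i → v j = 0 := fun j hj =>
      congrFun (congrArg Prod.snd hv : proj v = 0) ⟨j, hj⟩
    rw [hLapp, Finset.sum_eq_single i (fun j _ hj => by rw [hv2 j hj, mul_zero]) (by simp)] at hv1
    have hvi : v i = 0 := (mul_eq_zero.1 hv1).resolve_left hx.2
    ext j
    by_cases hj : j = i
    · rw [hj]; exact hvi
    · exact hv2 j hj
  obtain ⟨K, hK, hanti⟩ := LinearMap.exists_antilipschitzWith _ hinj
  have hK' : (0 : ℝ) < K := hK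
  have hbound : ∀ v : Rn n, ‖v‖ ≤ K * max ‖L v‖ ‖proj v‖ := by
    intro v
    have := hanti.le_mul_dist v 0
    rw [map_zero, dist_zero_right, dist_zero_right] at this
    exact this
  have hc : (0 : ℝ) < 1 / (2 * K) := by positivity
  have hev := hstrict.isLittleO.bound hc
  rw [nhds_prod_eq] at hev
  obtain ⟨U, hU, hUP'⟩ := eventually_prod_self_iff'.1 hev
  have hUP : ∀ y ∈ U, ∀ z ∈ U, ‖polyEval P y - polyEval P z - L (y - z)‖ ≤
      1 / (2 * K) * ‖y - z‖ := fun y hy z hz => hUP' y hy z hz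
  have hmem : s ∩ U ∈ 𝓝[s] x := inter_mem self_mem_nhdsWithin (mem_nhdsWithin_of_mem_nhds hU)
  refine (hdim _ hmem).not_ge ?_
  have hanti' : AntilipschitzWith K (fun y : (s ∩ U : Set (Rn n)) => proj y.1) := by
    apply AntilipschitzWith.of_le_mul_dist
    rintro ⟨y, hy, hyU⟩ ⟨z, hz, hzU⟩
    have h1 := hUP y hyU z hzU
    simp only [hy.1, hz.1, sub_self, zero_sub, norm_neg] at h1
    have h2 := hbound (y - z)
    rw [Subtype.dist_eq, dist_eq_norm, dist_eq_norm, ← map_sub]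
    rcases le_total ‖L (y - z)‖ ‖proj (y - z)‖ with h | h
    · rwa [max_eq_right h] at h2
    · rw [max_eq_left h] at h2
      have h3 : (K : ℝ) * ‖L (y - z)‖ ≤ K * (1 / (2 * K) * ‖y - z‖) := by gcongr
      have h4 : (K : ℝ) * (1 / (2 * K) * ‖y - z‖) = ‖y - z‖ / 2 := by field_simp
      have h5 : 0 ≤ (K : ℝ) * ‖proj (y - z)‖ := by positivity
      linarith [norm_nonneg (y - z)]
  calc dimH (s ∩ U) = dimH (Subtype.val '' (univ : Set (s ∩ U : Set (Rn n)))) := by simp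
    _ = dimH (univ : Set (s ∩ U : Set (Rn n))) := isometry_subtype_coe.dimH_image _
    _ ≤ dimH ((fun y : (s ∩ U : Set (Rn n)) => proj y.1) '' univ) := hanti'.le_dimH_image _
    _ ≤ dimH (univ : Set ({j : Fin n // j ≠ i} → ℝ)) := dimH_mono (subset_univ _)
    _ = ((n - 1 : ℕ) : ℝ≥0∞) := by
      rw [Real.dimH_univ_pi]; simp [Fintype.card_subtype_compl]

/-- The zero set of a nonzero polynomial has Hausdorff dimension at most `n - 1`: a zero is either a
zero of a nonzero partial derivative, which has smaller degree, or a regular zero. -/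
theorem dimH_zeros_le {n : ℕ} {P : MvPolynomial (Fin n) ℝ} (hP : P ≠ 0) :
    dimH {x : Rn n | polyEval P x = 0} ≤ ((n - 1 : ℕ) : ℝ≥0∞) := by
  obtain ⟨d, hd⟩ : ∃ d, P.totalDegree ≤ d := ⟨_, le_rfl⟩
  induction d generalizing P with
  | zero =>
    obtain ⟨a, ha⟩ : ∃ a, P = MvPolynomial.C a :=
      ⟨_, MvPolynomial.totalDegree_eq_zero_iff_eq_C.1 (Nat.le_zero.1 hd)⟩
    have ha0 : a ≠ 0 := fun h => hP (by rw [ha, h, MvPolynomial.C_0])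
    have : {x : Rn n | polyEval P x = 0} = ∅ := by
      ext x; simp [ha, polyEval, ha0]
    rw [this, dimH_empty]; exact bot_le
  | succ d ih =>
    by_cases h0 : P.totalDegree = 0
    · exact ih hP (by omega)
    obtain ⟨i, hi⟩ := exists_pderiv_ne_zero h0
    refine (dimH_mono (t := {x : Rn n | polyEval P x = 0 ∧
      polyEval (MvPolynomial.pderiv i P) x ≠ 0} ∪
      {x : Rn n | polyEval (MvPolynomial.pderiv i P) x = 0}) fun x hx => ?_).trans ?_
    · by_cases h : polyEval (MvPolynomial.pderiv i P) x = 0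
      · exact Or.inr h
      · exact Or.inl ⟨hx, h⟩
    · rw [dimH_union]
      exact max_le (dimH_regular_zeros_le P i) (ih hi (totalDegree_pderiv_le hd i))

theorem hausdorffMeasure_zeros {n : ℕ} (hn : 1 ≤ n) {s : ℝ} (hs : (n : ℝ) - 1 < s)
    {P : MvPolynomial (Fin n) ℝ} (hP : P ≠ 0) :
    μH[s] {x : Rn n | polyEval P x = 0} = 0 := by
  have hcast : ((n - 1 : ℕ) : ℝ) = n - 1 := by push_cast [hn]; ring
  have hs0 : 0 ≤ s := by
    have : (0 : ℝ) ≤ ((n - 1 : ℕ) : ℝ) := by positivity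
    linarith
  lift s to ℝ≥0 using hs0
  refine hausdorffMeasure_of_dimH_lt ((dimH_zeros_le hP).trans_lt ?_)
  have : ((n - 1 : ℕ) : ℝ≥0) < s := by
    rw [← NNReal.coe_lt_coe, NNReal.coe_natCast, hcast]; exact hs
  exact_mod_cast this

/-! ### Cubes and regular measures -/

variable {n : ℕ}

theorem isClosed_cube (x : Rn n) (r : ℝ) : IsClosed (cube x r) := by
  simp only [cube, ofPred_forall]
  refine isClosed_iInter fun i => isClosed_le ?_ continuous_const
  exact ((EuclideanSpace.proj (𝕜 := ℝ) i).continuous.sub continuous_const).abs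

theorem measurableSet_cube (x : Rn n) (r : ℝ) : MeasurableSet (cube x r) :=
  (isClosed_cube x r).measurableSet

theorem mem_cube_self (x : Rn n) {r : ℝ} (hr : 0 ≤ r) : x ∈ cube x r := fun i => by simpa using hr

theorem mem_cube_comm {x y : Rn n} {r : ℝ} : y ∈ cube x r ↔ x ∈ cube y r := by
  simp only [cube, mem_ofPred_eq, abs_sub_comm]

theorem cube_mono (x : Rn n) {r t : ℝ} (h : r ≤ t) : cube x r ⊆ cube x t :=
  fun _ hy i => (hy i).trans h

theorem cube_subset_cube {x y : Rn n} {r t u : ℝ} (hy : y ∈ cube x r) (h : r + t ≤ u) :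
    cube y t ⊆ cube x u := by
  intro z hz i
  have h1 := hz i
  have h2 := hy i
  have h3 := abs_sub_le (z i) (y i) (x i)
  linarith

theorem closedBall_subset_cube (x : Rn n) (r : ℝ) : Metric.closedBall x r ⊆ cube x r := by
  intro y hy i
  rw [mem_closedBall_iff_norm] at hy
  simpa using (PiLp.norm_apply_le (y - x) i).trans hy

theorem cube_subset_closedBall (x : Rn n) {r : ℝ} (hr : 0 ≤ r) :
    cube x r ⊆ Metric.closedBall x (n * r) := by
  intro y hy
  rw [mem_closedBall_iff_norm, EuclideanSpace.norm_eq]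
  apply Real.sqrt_le_iff.2 ⟨by positivity, ?_⟩
  calc ∑ i, ‖(y - x) i‖ ^ 2 ≤ ∑ _i : Fin n, r ^ 2 := by
        refine Finset.sum_le_sum fun i _ => ?_
        have := hy i
        gcongr
        simpa using this
    _ = n * r ^ 2 := by simp
    _ ≤ (n * r) ^ 2 := by
      rcases Nat.eq_zero_or_pos n with h | h
      · simp [h]
      · have : (1 : ℝ) ≤ n := by exact_mod_cast h
        nlinarith [sq_nonneg r, mul_nonneg (sub_nonneg.2 this) (sq_nonneg r)]

theorem cube_mem_nhds (x : Rn n) {r : ℝ} (hr : 0 < r) : cube x r ∈ 𝓝 x :=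
  mem_of_superset (Metric.closedBall_mem_nhds x hr) (closedBall_subset_cube x r)

theorem isCompact_cube (x : Rn n) (r : ℝ) : IsCompact (cube x r) := by
  rcases le_or_gt 0 r with hr | hr
  · exact (isCompact_closedBall x (n * r)).of_isClosed_subset (isClosed_cube x r)
      (cube_subset_closedBall x hr)
  · rcases isEmpty_or_nonempty (Fin n) with h | ⟨⟨i⟩⟩
    · have : Subsingleton (Rn n) := ⟨fun a b => by ext i; exact h.elim i⟩
      exact (Set.subsingleton_of_subsingleton.finite).isCompact
    · have : cube x r = ∅ := by
        ext y
        simp only [cube, mem_ofPred_eq, mem_empty_iff_false, iff_false, not_forall]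
        exact ⟨i, fun h => by linarith [abs_nonneg (y i - x i)]⟩
      rw [this]; exact isCompact_empty

theorem ediam_cube_le (x : Rn n) {r : ℝ} (hr : 0 ≤ r) :
    Metric.ediam (cube x r) ≤ ENNReal.ofReal (2 * n * r) := by
  refine (Metric.ediam_mono (cube_subset_closedBall x hr)).trans ?_
  rw [← Metric.closedEBall_ofReal (by positivity)]
  refine Metric.ediam_closedEBall_le.trans ?_
  rw [mul_assoc, ENNReal.ofReal_mul (p := 2) (by norm_num)]
  simp

/-- The part of the `s`-set condition that the argument uses, for a measure `μ` carried by `T`: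
two-sided `s`-regularity on the cubes of size at most `R`, and the doubling property with constant
`K` on all cubes centred on `T`. The lower bound may fail for large cubes, since `T` may be
bounded. -/
structure IsRegular (μ : Measure (Rn n)) (T : Set (Rn n)) (s R c₁ c₂ : ℝ) (K : ℝ≥0) : Prop where
  pos : 0 < R ∧ 0 < c₁ ∧ 0 < c₂
  ae_mem : ∀ᵐ x ∂μ, x ∈ T
  finite : ∀ x r, μ (cube x r) < ∞
  lower : ∀ x ∈ T, ∀ r, 0 < r → r ≤ R → ENNReal.ofReal (c₁ * r ^ s) ≤ μ (cube x r)
  upper : ∀ x r, 0 < r → r ≤ R → μ (cube x r) ≤ ENNReal.ofReal (c₂ * r ^ s)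
  doubling : ∀ x ∈ T, ∀ r, 0 < r → μ (cube x (2 * r)) ≤ K * μ (cube x r)

theorem measureOn_cube (s : ℝ) (S : Set (Rn n)) (x : Rn n) (r : ℝ) :
    measureOn s S (cube x r) = μH[s] (cube x r ∩ S) :=
  Measure.restrict_apply (measurableSet_cube x r)

theorem ae_mem_closure_measureOn (s : ℝ) (S : Set (Rn n)) :
    ∀ᵐ x ∂(measureOn s S), x ∈ closure S := by
  rw [ae_iff]
  have : {a | a ∉ closure S} = (closure S)ᶜ := rfl
  rw [this, measureOn, Measure.restrict_apply isClosed_closure.measurableSet.compl]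
  have : (closure S)ᶜ ∩ S = ∅ := by
    ext x; simp only [mem_inter_iff, mem_compl_iff, mem_empty_iff_false, iff_false, not_and]
    exact fun h hx => h (subset_closure hx)
  rw [this, measure_empty]

theorem cube_subset_of_mem_closure {S : Set (Rn n)} {x : Rn n} (hx : x ∈ closure S) {r t : ℝ}
    (h : r < t) : ∃ y ∈ S, cube y r ⊆ cube x t := by
  obtain ⟨y, hyx, hyS⟩ := mem_closure_iff_nhds.1 hx _ (cube_mem_nhds x (sub_pos.2 h))
  exact ⟨y, hyS, cube_subset_cube hyx (by linarith)⟩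

/-- An upper bound on cubes centred on `S` gives one on all cubes. -/
theorem measureOn_cube_le {s c₂ : ℝ} {S : Set (Rn n)} {r : ℝ}
    (h : ∀ x ∈ S, measureOn s S (cube x (2 * r)) ≤ ENNReal.ofReal (c₂ * (2 * r) ^ s)) (x : Rn n) :
    measureOn s S (cube x r) ≤ ENNReal.ofReal (c₂ * (2 * r) ^ s) := by
  by_cases hne : (cube x r ∩ S).Nonempty
  · obtain ⟨y, hyx, hyS⟩ := hne
    refine (measure_mono ?_).trans (h y hyS)
    exact cube_subset_cube (mem_cube_comm.1 hyx) (by linarith)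
  · rw [measureOn_cube, not_nonempty_iff_eq_empty.1 hne, measure_empty]
    exact bot_le

theorem isRegular_zero (s : ℝ) {R : ℝ} (hR : 0 < R) :
    IsRegular (0 : Measure (Rn n)) ∅ s R 1 1 0 :=
  ⟨⟨hR, one_pos, one_pos⟩, by simp, by simp, by simp, by simp, by simp⟩

/-- The unbounded case: the regularity bounds hold at all scales. -/
theorem isRegular_of_unbounded {s c₁ c₂ : ℝ} (hc₁ : 0 < c₁) (hc₂ : 0 < c₂)
    {S : Set (Rn n)} {R : ℝ} (hR : 0 < R)
    (h : ∀ x ∈ S, ∀ r : ℝ, 0 < r → ENNReal.ofReal (c₁ * r ^ s) ≤ measureOn s S (cube x r) ∧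
      measureOn s S (cube x r) ≤ ENNReal.ofReal (c₂ * r ^ s)) :
    IsRegular (measureOn s S) (closure S) s R (c₁ * (1 / 2) ^ s) (c₂ * 2 ^ s)
      (c₂ * 8 ^ s / c₁).toNNReal := by
  have hlow : ∀ x ∈ closure S, ∀ r : ℝ, 0 < r →
      ENNReal.ofReal (c₁ * (r / 2) ^ s) ≤ measureOn s S (cube x r) := by
    intro x hx r hr
    obtain ⟨y, hy, hyx⟩ := cube_subset_of_mem_closure hx (show r / 2 < r by linarith)
    exact ((h y hy _ (by positivity)).1).trans (measure_mono hyx)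
  have hup : ∀ x, ∀ r : ℝ, 0 < r →
      measureOn s S (cube x r) ≤ ENNReal.ofReal (c₂ * (2 * r) ^ s) := fun x r hr =>
    measureOn_cube_le (fun x hx => (h x hx (2 * r) (by positivity)).2) x
  refine ⟨⟨hR, by positivity, by positivity⟩, ae_mem_closure_measureOn s S, ?_, ?_, ?_, ?_⟩
  · intro x r
    refine (measure_mono (cube_mono x (show r ≤ max r 1 from le_max_left _ _))).trans_lt ?_
    exact (hup x _ (by positivity)).trans_lt ENNReal.ofReal_lt_top
  · intro x hx r hr _
    convert hlow x hx r hr using 2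
    rw [mul_assoc, ← Real.mul_rpow (by norm_num) hr.le]; ring_nf
  · intro x r hr _
    convert hup x r hr using 2
    rw [mul_assoc, ← Real.mul_rpow (by norm_num) hr.le]
  · intro x hx r hr
    calc measureOn s S (cube x (2 * r)) ≤ ENNReal.ofReal (c₂ * (2 * (2 * r)) ^ s) :=
          hup x _ (by positivity)
      _ = ENNReal.ofReal (c₂ * 8 ^ s / c₁) * ENNReal.ofReal (c₁ * (r / 2) ^ s) := by
        rw [← ENNReal.ofReal_mul (by positivity)]
        congr 1
        rw [show 2 * (2 * r) = 8 * (r / 2) by ring, Real.mul_rpow (by norm_num) (by positivity)]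
        field_simp
      _ ≤ _ := by
        gcongr
        · exact le_rfl
        · exact hlow x hx r hr

/-- The bounded case: the regularity bounds hold up to some scale `r₀`, and `μ` is finite. -/
theorem exists_isRegular_of_bounded {s c₁ c₂ r₀ : ℝ} (hs : 0 < s) (hc₁ : 0 < c₁) (hc₂ : 0 < c₂)
    (hr₀ : 0 < r₀) {S : Set (Rn n)} (hS : Bornology.IsBounded S) {R : ℝ} (hR : 0 < R)
    (h : ∀ x ∈ S, ∀ r : ℝ, 0 < r → r ≤ r₀ →
      ENNReal.ofReal (c₁ * r ^ s) ≤ measureOn s S (cube x r) ∧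
      measureOn s S (cube x r) ≤ ENNReal.ofReal (c₂ * r ^ s)) :
    ∃ c₁' c₂' K, IsRegular (measureOn s S) (closure S) s R c₁' c₂' K := by
  have hup : ∀ x, ∀ r : ℝ, 0 < r → 2 * r ≤ r₀ →
      measureOn s S (cube x r) ≤ ENNReal.ofReal (c₂ * (2 * r) ^ s) := fun x r hr hr' =>
    measureOn_cube_le (fun x hx => (h x hx (2 * r) (by positivity) hr').2) x
  -- `μ` is locally finite and carried by a compact set
  have hloc : IsLocallyFiniteMeasure (measureOn s S) := ⟨fun x =>
    ⟨cube x (r₀ / 2), cube_mem_nhds x (by positivity),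
      (hup x _ (by positivity) (by linarith)).trans_lt ENNReal.ofReal_lt_top⟩⟩
  have hfin : measureOn s S univ < ∞ := by
    have h1 : measureOn s S univ = measureOn s S (closure S) :=
      measure_congr (by
        filter_upwards [ae_mem_closure_measureOn s S] with x hx
        exact propext ⟨fun _ => hx, fun _ => mem_univ x⟩)
    rw [h1]
    exact hS.isCompact_closure.measure_lt_top
  set M : ℝ := (measureOn s S univ).toReal with hM
  have hMle : ∀ A, measureOn s S A ≤ ENNReal.ofReal M := fun A => by
    rw [hM, ENNReal.ofReal_toReal hfin.ne]; exact measure_mono (subset_univ _)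
  have hM0 : 0 ≤ M := ENNReal.toReal_nonneg
  -- a single lower bound, valid for all radii
  have hlow : ∀ x ∈ closure S, ∀ r t : ℝ, 0 < t → t < r → t ≤ r₀ →
      ENNReal.ofReal (c₁ * t ^ s) ≤ measureOn s S (cube x r) := by
    intro x hx r t ht htr htr₀
    obtain ⟨y, hy, hyx⟩ := cube_subset_of_mem_closure hx htr
    exact ((h y hy _ ht htr₀).1).trans (measure_mono hyx)
  set κ : ℝ := min (1 / 2) (r₀ / R)
  have hκ0 : 0 < κ := by positivity
  refine ⟨c₁ * κ ^ s, c₂ * 2 ^ s + M * (2 / r₀) ^ s,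
    (c₂ * 8 ^ s / c₁).toNNReal + (M / (c₁ * (r₀ / 8) ^ s)).toNNReal,
    ⟨hR, by positivity, by positivity⟩, ae_mem_closure_measureOn s S, ?_, ?_, ?_, ?_⟩
  · exact fun x r => (measure_mono (subset_univ _)).trans_lt hfin
  · intro x hx r hr hrR
    rw [mul_assoc, ← Real.mul_rpow hκ0.le hr.le]
    refine hlow x hx r (κ * r) (by positivity) ?_ ?_
    · have : κ ≤ 1 / 2 := min_le_left _ _
      nlinarith
    · have : κ ≤ r₀ / R := min_le_right _ _
      calc κ * r ≤ r₀ / R * R := by gcongr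
        _ = r₀ := by field_simp
  · intro x r hr _
    rw [add_mul, ENNReal.ofReal_add (by positivity) (by positivity)]
    rcases le_total (2 * r) r₀ with hle | hle
    · refine le_add_right ?_
      rw [mul_assoc, ← Real.mul_rpow (by norm_num) hr.le]
      exact hup x r hr hle
    · refine le_add_left ((hMle _).trans (ENNReal.ofReal_le_ofReal ?_))
      rw [mul_assoc, ← Real.mul_rpow (by positivity) hr.le]
      have h1 : 1 ≤ 2 / r₀ * r := by
        rw [div_mul_eq_mul_div, le_div_iff₀ hr₀]; linarith
      nlinarith [Real.one_le_rpow h1 hs.le]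
  · intro x hx r hr
    rw [ENNReal.coe_add, add_mul]
    rcases le_total (4 * r) r₀ with hle | hle
    · refine le_add_right ?_
      calc measureOn s S (cube x (2 * r)) ≤ ENNReal.ofReal (c₂ * (2 * (2 * r)) ^ s) :=
            hup x _ (by positivity) (by linarith)
        _ = ENNReal.ofReal (c₂ * 8 ^ s / c₁) * ENNReal.ofReal (c₁ * (r / 2) ^ s) := by
          rw [← ENNReal.ofReal_mul (by positivity)]
          congr 1
          rw [show 2 * (2 * r) = 8 * (r / 2) by ring, Real.mul_rpow (by norm_num) (by positivity)]
          field_simp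
        _ ≤ _ := by
          gcongr
          · exact le_rfl
          · exact hlow x hx r _ (by positivity) (by linarith) (by linarith)
    · refine le_add_left ?_
      calc measureOn s S (cube x (2 * r)) ≤ ENNReal.ofReal M := hMle _
        _ = ENNReal.ofReal (M / (c₁ * (r₀ / 8) ^ s)) * ENNReal.ofReal (c₁ * (r₀ / 8) ^ s) := by
          rw [← ENNReal.ofReal_mul (by positivity)]
          congr 1
          field_simp
        _ ≤ _ := by
          gcongr
          · exact le_rfl
          · exact hlow x hx r _ (by positivity) (by linarith) (by linarith)

/-- The measure of an `s`-set is regular. If `S` has at most one point, the defining condition is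
void, but then the measure vanishes. -/
theorem IsSSet.exists_isRegular {s : ℝ} (hs : 0 < s) {S : Set (Rn n)} (hS : IsSSet s S) {R : ℝ}
    (hR : 0 < R) : ∃ T c₁ c₂ K, IsRegular (measureOn s S) T s R c₁ c₂ K := by
  obtain ⟨c₁, c₂, hc₁, hc₂, h⟩ := hS
  simp only [← measureOn_cube] at h
  rcases S.subsingleton_or_nontrivial with hsub | hnt
  · have h0 : measureOn s S = 0 := by
      have := Measure.nullSingletonClass_hausdorff (Rn n) hs
      exact Measure.restrict_eq_zero.2 (hsub.measure_zero _)
    rw [h0]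
    exact ⟨_, _, _, _, isRegular_zero s hR⟩
  · have hpos : 0 < Metric.ediam S := Metric.ediam_pos_iff.2 hnt
    by_cases htop : Metric.ediam S = ∞
    · exact ⟨_, _, _, _, isRegular_of_unbounded hc₁ hc₂ hR
        fun x hx r hr => h x hx r hr (by rw [htop]; exact le_top)⟩
    · set D := (Metric.ediam S).toReal with hD
      have hD0 : 0 < D := ENNReal.toReal_pos hpos.ne' htop
      have hb : Bornology.IsBounded S := Metric.isBounded_iff_ediam_ne_top.2 htop
      have hr₀ : 0 < D / (2 * n + 1) := by positivity
      refine ⟨_, exists_isRegular_of_bounded hs hc₁ hc₂ hr₀ hb hR fun x hx r hr hr' => ?_⟩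
      refine h x hx r hr ((ediam_cube_le x hr.le).trans ?_)
      rw [← ENNReal.ofReal_toReal htop]
      apply ENNReal.ofReal_le_ofReal
      rw [le_div_iff₀ (by positivity)] at hr'
      nlinarith

/-! ### Sublevel sets of polynomials -/

/-- A set of `s`-dimensional Hausdorff measure zero is covered by small balls with arbitrarily small
sum of the `s`-th powers of the radii. -/
theorem exists_ball_cover_of_hausdorffMeasure_zero {s : ℝ} (hs : 0 < s) {Z : Set (Rn n)}
    (hZ : μH[s] Z = 0) {ε : ℝ≥0∞} (hε : ε ≠ 0) :
    ∃ (z : ℕ → Rn n) (ρ : ℕ → ℝ), (∀ j, 0 < ρ j ∧ ρ j ≤ 1) ∧ Z ⊆ ⋃ j, Metric.ball (z j) (ρ j) ∧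
      ∑' j, ENNReal.ofReal (ρ j ^ s) ≤ ε := by
  have h2s : (2 : ℝ≥0∞) * 2 ^ s ≠ 0 := by simp
  have h2s' : (2 : ℝ≥0∞) * 2 ^ s ≠ ∞ := ENNReal.mul_ne_top (by simp) (by simp)
  set ε' : ℝ≥0∞ := ε / (2 * 2 ^ s) with hε'
  have hε'0 : ε' ≠ 0 := by simp [hε', hε, h2s']
  rw [Measure.hausdorffMeasure_apply] at hZ
  simp only [ENNReal.iSup_eq_zero] at hZ
  have h4 := hZ (1 / 2) (by simp)
  have hlt := pos_iff_ne_zero.2 hε'0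
  rw [← h4] at hlt
  simp only [iInf_lt_iff] at hlt
  obtain ⟨t, htZ, htd, hsum⟩ := hlt
  obtain ⟨e, he0, hesum⟩ := ENNReal.exists_pos_sum_of_countable hε'0 ℕ
  have hd : ∀ j, Metric.ediam (t j) ≠ ∞ := fun j => ((htd j).trans_lt (by simp)).ne
  set g : ℕ → ℝ := fun j => min ((e j : ℝ) ^ (1 / s)) (1 / 2) with hg
  have hg0 : ∀ j, 0 < g j := fun j => lt_min (Real.rpow_pos_of_pos (he0 j) _) (by norm_num)
  set ρ : ℕ → ℝ := fun j => (Metric.ediam (t j)).toReal + g j with hρ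
  have hz : ∃ z : ℕ → Rn n, ∀ j, (t j).Nonempty → z j ∈ t j := by
    choose! z hz using fun j (h : (t j).Nonempty) => h
    exact ⟨z, hz⟩
  obtain ⟨z, hz⟩ := hz
  refine ⟨z, ρ, fun j => ⟨add_pos_of_nonneg_of_pos ENNReal.toReal_nonneg (hg0 j), ?_⟩, ?_, ?_⟩
  · have h1 : (Metric.ediam (t j)).toReal ≤ 1 / 2 := by
      have := ENNReal.toReal_mono (by simp) (htd j)
      simpa using this
    have h2 : g j ≤ 1 / 2 := min_le_right _ _
    simp only [hρ]; linarith
  · refine htZ.trans (iUnion_mono fun j y hy => ?_)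
    rw [Metric.mem_ball]
    have h1 : edist y (z j) ≤ Metric.ediam (t j) :=
      Metric.edist_le_ediam_of_mem hy (hz j ⟨y, hy⟩)
    have h2 : dist y (z j) ≤ (Metric.ediam (t j)).toReal := by
      rw [dist_edist]; exact ENNReal.toReal_mono (hd j) h1
    exact h2.trans_lt (lt_add_of_pos_right _ (hg0 j))
  · have hterm : ∀ j, ENNReal.ofReal (ρ j ^ s) ≤
        2 ^ s * ((⨆ _ : (t j).Nonempty, Metric.ediam (t j) ^ s) + e j) := by
      intro j
      have h1 : (⨆ _ : (t j).Nonempty, Metric.ediam (t j) ^ s) = Metric.ediam (t j) ^ s := by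
        rcases (t j).eq_empty_or_nonempty with h | h
        · simp [h, hs]
        · simp [h]
      have h2 : ENNReal.ofReal (g j) ^ s ≤ e j := by
        have : ENNReal.ofReal (g j) ≤ (e j : ℝ≥0∞) ^ (1 / s) := by
          rw [← ENNReal.ofReal_coe_nnreal, ENNReal.ofReal_rpow_of_nonneg (by positivity)
            (by positivity)]
          exact ENNReal.ofReal_le_ofReal (min_le_left _ _)
        calc ENNReal.ofReal (g j) ^ s ≤ ((e j : ℝ≥0∞) ^ (1 / s)) ^ s := by gcongr
          _ = e j := by rw [← ENNReal.rpow_mul, one_div_mul_cancel hs.ne', ENNReal.rpow_one]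
      rw [h1, ← ENNReal.ofReal_rpow_of_nonneg (by positivity) hs.le, hρ,
        ENNReal.ofReal_add ENNReal.toReal_nonneg (hg0 j).le, ENNReal.ofReal_toReal (hd j)]
      set a := Metric.ediam (t j)
      set b := ENNReal.ofReal (g j)
      calc (a + b) ^ s ≤ (2 * max a b) ^ s := by
            gcongr; rw [two_mul]; exact add_le_add (le_max_left _ _) (le_max_right _ _)
        _ = 2 ^ s * (max a b) ^ s := ENNReal.mul_rpow_of_nonneg _ _ hs.le
        _ ≤ 2 ^ s * (a ^ s + b ^ s) := by
          gcongr
          rcases le_total a b with h | h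
          · rw [max_eq_right h]; exact le_add_self
          · rw [max_eq_left h]; exact le_self_add
        _ ≤ _ := by gcongr
    calc ∑' j, ENNReal.ofReal (ρ j ^ s) ≤ ∑' j, 2 ^ s *
          ((⨆ _ : (t j).Nonempty, Metric.ediam (t j) ^ s) + e j) := ENNReal.tsum_le_tsum hterm
      _ = 2 ^ s * (∑' j, (⨆ _ : (t j).Nonempty, Metric.ediam (t j) ^ s) + ∑' j, (e j : ℝ≥0∞)) := by
        rw [ENNReal.tsum_mul_left, ENNReal.tsum_add]
      _ ≤ 2 ^ s * (ε' + ε') := by gcongr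
      _ = (2 * 2 ^ s) * ε' := by ring
      _ = ε := ENNReal.mul_div_cancel h2s h2s'

/-- On every cube, the set where a given nonzero polynomial, transported to that cube, is small has
small relative measure: its zero set in the unit cube has `H^s`-measure zero because `s > n - 1`, and
the open set formed by a cover of it contains a sublevel set. -/
theorem IsRegular.measure_sublevel_le {μ : Measure (Rn n)} {T : Set (Rn n)} {s R c₁ c₂ : ℝ}
    {K : ℝ≥0} (h : IsRegular μ T s R c₁ c₂ K) (hn : 1 ≤ n) (hs₀ : 0 < s) (hs : (n : ℝ) - 1 < s)
    {P : MvPolynomial (Fin n) ℝ} (hP : P ≠ 0) {ε : ℝ} (hε : 0 < ε) :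
    ∃ η : ℝ, 0 < η ∧ ∀ x : Rn n, ∀ r, 0 < r → r ≤ R →
      μ {y ∈ cube x r | |polyEval P (r⁻¹ • (y - x))| < η} ≤ ENNReal.ofReal (ε * r ^ s) := by
  obtain ⟨hR, hc₁, hc₂⟩ := h.pos
  obtain ⟨z, ρ, hρ, hcov, hsum⟩ := exists_ball_cover_of_hausdorffMeasure_zero hs₀
    (hausdorffMeasure_zeros hn hs hP) (ε := ENNReal.ofReal (ε / c₂))
    (by simpa using div_pos hε hc₂)
  have hcomp : IsCompact (cube (0 : Rn n) 1 \ ⋃ j, Metric.ball (z j) (ρ j)) :=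
    (isCompact_cube 0 1).diff (isOpen_iUnion fun j => Metric.isOpen_ball)
  obtain ⟨η, hη, hle⟩ : ∃ η : ℝ, 0 < η ∧
      ∀ w ∈ cube (0 : Rn n) 1 \ ⋃ j, Metric.ball (z j) (ρ j), η ≤ |polyEval P w| := by
    rcases (cube (0 : Rn n) 1 \ ⋃ j, Metric.ball (z j) (ρ j)).eq_empty_or_nonempty with he | hne
    · exact ⟨1, one_pos, by simp [he]⟩
    · obtain ⟨w, hw, hmin⟩ := hcomp.exists_isMinOn hne
        (continuous_polyEval P).abs.continuousOn
      exact ⟨|polyEval P w|, abs_pos.2 fun h0 => hw.2 (hcov h0), fun w' hw' => hmin hw'⟩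
  refine ⟨η, hη, fun x r hr hrR => ?_⟩
  have hsub : {y ∈ cube x r | |polyEval P (r⁻¹ • (y - x))| < η} ⊆
      ⋃ j, cube (x + r • z j) (r * ρ j) := by
    rintro y ⟨hy, hyη⟩
    have h1 : r⁻¹ • (y - x) ∈ cube (0 : Rn n) 1 := by
      intro i
      have := hy i
      simp only [PiLp.smul_apply, PiLp.sub_apply, PiLp.zero_apply, sub_zero, smul_eq_mul, abs_mul,
        abs_inv, abs_of_pos hr]
      rwa [inv_mul_le_iff₀ hr, mul_one]
    have h2 : r⁻¹ • (y - x) ∈ ⋃ j, Metric.ball (z j) (ρ j) := by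
      by_contra hcon
      exact (hle _ ⟨h1, hcon⟩).not_gt hyη
    obtain ⟨j, hj⟩ := mem_iUnion.1 h2
    refine mem_iUnion.2 ⟨j, closedBall_subset_cube _ _ ?_⟩
    rw [Metric.mem_ball, dist_eq_norm] at hj
    rw [mem_closedBall_iff_norm]
    have : y - (x + r • z j) = r • (r⁻¹ • (y - x) - z j) := by
      rw [smul_sub, smul_inv_smul₀ hr.ne']; abel
    rw [this, norm_smul, Real.norm_of_nonneg hr.le]
    gcongr
  calc μ {y ∈ cube x r | |polyEval P (r⁻¹ • (y - x))| < η}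
      ≤ ∑' j, μ (cube (x + r • z j) (r * ρ j)) := (measure_mono hsub).trans (measure_iUnion_le _)
    _ ≤ ∑' j, ENNReal.ofReal (c₂ * r ^ s) * ENNReal.ofReal (ρ j ^ s) := by
      refine ENNReal.tsum_le_tsum fun j => ?_
      have hρj := hρ j
      refine (h.upper _ _ (mul_pos hr hρj.1) (by nlinarith)).trans_eq ?_
      rw [← ENNReal.ofReal_mul (by positivity), Real.mul_rpow hr.le hρj.1.le, mul_assoc]
    _ = ENNReal.ofReal (c₂ * r ^ s) * ∑' j, ENNReal.ofReal (ρ j ^ s) := ENNReal.tsum_mul_left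
    _ ≤ ENNReal.ofReal (c₂ * r ^ s) * ENNReal.ofReal (ε / c₂) := by gcongr
    _ = ENNReal.ofReal (ε * r ^ s) := by
      rw [← ENNReal.ofReal_mul (by positivity)]
      congr 1
      field_simp

/-- The space of polynomials of degree at most `d` in coordinates. -/
theorem exists_polynomial_coordinates (n d : ℕ) :
    ∃ (N : ℕ) (F : (Fin N → ℝ) →ₗ[ℝ] MvPolynomial (Fin n) ℝ), Function.Injective F ∧
      (∀ c, (F c).totalDegree ≤ d) ∧ ∀ P, P.totalDegree ≤ d → ∃ c, F c = P := by
  let b := Module.finBasis ℝ (MvPolynomial.restrictTotalDegree (Fin n) ℝ d)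
  refine ⟨_, (Submodule.subtype _).comp b.equivFun.symm.toLinearMap, ?_, ?_, ?_⟩
  · exact Subtype.val_injective.comp b.equivFun.symm.injective
  · intro c
    exact (MvPolynomial.mem_restrictTotalDegree _ _ _).1 (b.equivFun.symm c).2
  · intro P hP
    refine ⟨b.equivFun ⟨P, (MvPolynomial.mem_restrictTotalDegree _ _ _).2 hP⟩, ?_⟩
    simp

/-- Composition of a polynomial with the affine map `y ↦ x + r y`. -/
noncomputable def affineComp (x : Rn n) (r : ℝ) (P : MvPolynomial (Fin n) ℝ) :
    MvPolynomial (Fin n) ℝ :=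
  MvPolynomial.bind₁ (fun i => MvPolynomial.C (x i) + MvPolynomial.C r * MvPolynomial.X i) P

theorem polyEval_affineComp (x : Rn n) (r : ℝ) (P : MvPolynomial (Fin n) ℝ) (y : Rn n) :
    polyEval (affineComp x r P) y = polyEval P (x + r • y) := by
  simp only [polyEval, affineComp]
  rw [← MvPolynomial.coe_aeval_eq_eval, ← MvPolynomial.coe_aeval_eq_eval]
  simp only [RingHom.coe_coe, MvPolynomial.aeval_bind₁]
  congr 2
  funext i
  simp

theorem totalDegree_affineComp_le (x : Rn n) (r : ℝ) {P : MvPolynomial (Fin n) ℝ} {d : ℕ}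
    (hP : P.totalDegree ≤ d) : (affineComp x r P).totalDegree ≤ d := by
  rw [affineComp, MvPolynomial.bind₁, MvPolynomial.aeval_def, MvPolynomial.eval₂_eq']
  refine MvPolynomial.totalDegree_finsetSum_le fun m hm => ?_
  refine (MvPolynomial.totalDegree_mul _ _).trans ?_
  have h1 : (algebraMap ℝ (MvPolynomial (Fin n) ℝ) (MvPolynomial.coeff m P)).totalDegree = 0 :=
    MvPolynomial.totalDegree_C _
  rw [h1, zero_add]
  refine (MvPolynomial.totalDegree_finsetProd _ _).trans ?_
  calc _ ≤ ∑ i, m i := by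
        refine Finset.sum_le_sum fun i _ => ?_
        refine (MvPolynomial.totalDegree_pow _ _).trans ?_
        have h2 : (MvPolynomial.C (x i) + MvPolynomial.C r * MvPolynomial.X i :
            MvPolynomial (Fin n) ℝ).totalDegree ≤ 1 := by
          refine (MvPolynomial.totalDegree_add _ _).trans (max_le (by simp) ?_)
          refine (MvPolynomial.totalDegree_mul _ _).trans ?_
          simp [MvPolynomial.totalDegree_X]
        nlinarith
    _ = m.sum fun _ e => e := by rw [Finsupp.sum_fintype _ _ (by simp)]
    _ ≤ d := (MvPolynomial.le_totalDegree hm).trans hP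

/-! ### Averages and norm equivalence on polynomials -/

section Average

variable {μ : Measure (Rn n)}

theorem setLAverage_mono {Q : Set (Rn n)} (hQ : MeasurableSet Q) {u v : Rn n → ℝ≥0∞}
    (h : ∀ y ∈ Q, u y ≤ v y) : ⨍⁻ y in Q, u y ∂μ ≤ ⨍⁻ y in Q, v y ∂μ := by
  simp only [setLAverage_eq]
  exact ENNReal.div_le_div_right (setLIntegral_mono' hQ h) _

theorem setLAverage_add_le {Q : Set (Rn n)} (hQ : MeasurableSet Q) {u v w : Rn n → ℝ≥0∞}
    (hv : AEMeasurable v μ) (h : ∀ y ∈ Q, u y ≤ v y + w y) :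
    ⨍⁻ y in Q, u y ∂μ ≤ ⨍⁻ y in Q, v y ∂μ + ⨍⁻ y in Q, w y ∂μ := by
  refine (setLAverage_mono hQ h).trans_eq ?_
  simp only [setLAverage_eq]
  rw [lintegral_add_left' hv.restrict, ENNReal.add_div]

theorem setLAverage_const_le (Q : Set (Rn n)) (a : ℝ≥0∞) : ⨍⁻ _ in Q, a ∂μ ≤ a := by
  rw [setLAverage_eq, setLIntegral_const]
  exact ENNReal.div_le_of_le_mul le_rfl

/-- Averages over comparable nested sets are comparable. -/
theorem setLAverage_le_of_subset {A Q : Set (Rn n)} {K : ℝ≥0∞} (hAQ : A ⊆ Q) (hA : μ A ≠ 0)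
    (hK : μ Q ≤ K * μ A) (hQ : μ Q ≠ ∞) (u : Rn n → ℝ≥0∞) :
    ⨍⁻ y in A, u y ∂μ ≤ K * ⨍⁻ y in Q, u y ∂μ := by
  have hQ0 : μ Q ≠ 0 := fun h0 => hA (measure_mono_null hAQ h0)
  have hA' : μ A ≠ ∞ := ((measure_mono hAQ).trans_lt (lt_top_iff_ne_top.2 hQ)).ne
  simp only [setLAverage_eq]
  rw [ENNReal.div_le_iff hA hA']
  calc ∫⁻ y in A, u y ∂μ ≤ ∫⁻ y in Q, u y ∂μ := lintegral_mono_set hAQ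
    _ = (∫⁻ y in Q, u y ∂μ) / μ Q * μ Q := (ENNReal.div_mul_cancel hQ0 hQ).symm
    _ ≤ (∫⁻ y in Q, u y ∂μ) / μ Q * (K * μ A) := by gcongr
    _ = _ := by ring

end Average

namespace IsRegular

variable {μ : Measure (Rn n)} {T : Set (Rn n)} {s R c₁ c₂ : ℝ} {K : ℝ≥0}

theorem measure_cube_pos (h : IsRegular μ T s R c₁ c₂ K) {x : Rn n} (hx : x ∈ T) {r : ℝ}
    (hr : 0 < r) : 0 < μ (cube x r) := by
  obtain ⟨hR, hc₁, hc₂⟩ := h.pos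
  refine lt_of_lt_of_le ?_ (measure_mono (cube_mono x (min_le_left r R)))
  refine lt_of_lt_of_le ?_ (h.lower x hx _ (lt_min hr hR) (min_le_right _ _))
  rw [ENNReal.ofReal_pos]
  have : 0 < min r R := lt_min hr hR
  positivity

theorem isLocallyFiniteMeasure (h : IsRegular μ T s R c₁ c₂ K) : IsLocallyFiniteMeasure μ :=
  ⟨fun x => ⟨cube x 1, cube_mem_nhds x one_pos, h.finite x 1⟩⟩

theorem setLAverage_ne_top (h : IsRegular μ T s R c₁ c₂ K) {x : Rn n} (hx : x ∈ T) {r : ℝ}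
    (hr : 0 < r) {u : Rn n → ℝ≥0∞} (hu : ∫⁻ y in cube x r, u y ∂μ ≠ ∞) :
    ⨍⁻ y in cube x r, u y ∂μ ≠ ∞ := by
  rw [setLAverage_eq]
  exact ENNReal.div_ne_top hu (h.measure_cube_pos hx hr).ne'

/-- Norm equivalence on polynomials of degree at most `d`, uniform over all cubes of size at most
`R` centred on `T`: in the coordinates of the polynomial rescaled to the unit cube, both the
supremum over the cube and the average with respect to `μ` are comparable with the norm of the
coordinates. The bound by the average follows from the measure estimate for sublevel sets by
compactness of the unit sphere. -/
theorem exists_coordinates (h : IsRegular μ T s R c₁ c₂ K) (hn : 1 ≤ n) (hs₀ : 0 < s)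
    (hs : (n : ℝ) - 1 < s) (d : ℕ) :
    ∃ (N : ℕ) (F : (Fin N → ℝ) →ₗ[ℝ] MvPolynomial (Fin n) ℝ) (A B : ℝ≥0),
      (∀ c, (F c).totalDegree ≤ d) ∧ (∀ P, P.totalDegree ≤ d → ∃ c, F c = P) ∧
      (∀ c, ∀ x : Rn n, ∀ r, 0 < r → ∀ y ∈ cube x r,
        ‖polyEval (F c) (r⁻¹ • (y - x))‖ₑ ≤ B * ‖c‖ₑ) ∧
      ∀ c, ∀ x ∈ T, ∀ r, 0 < r → r ≤ R →
        ‖c‖ₑ ≤ A * ⨍⁻ y in cube x r, ‖polyEval (F c) (r⁻¹ • (y - x))‖ₑ ∂μ := by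
  obtain ⟨hR, hc₁, hc₂⟩ := h.pos
  obtain ⟨N, F, hinj, hdeg, hsurj⟩ := exists_polynomial_coordinates n d
  -- evaluation is jointly linear in the coordinates, hence bounded on the unit cube
  have heval : ∀ c y, polyEval (F c) y = ∑ j, c j * polyEval (F (Pi.single j 1)) y := by
    intro c y
    conv_lhs => rw [← LinearMap.sum_single_apply (fun _ => ℝ) c, map_sum]
    simp only [polyEval, map_sum]
    refine Finset.sum_congr rfl fun j _ => ?_
    have : (Pi.single j (c j) : Fin N → ℝ) = c j • Pi.single j 1 := by
      rw [← Pi.single_smul]; simp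
    rw [this, map_smul, MvPolynomial.smul_eval]
  have hsup : ∃ B : ℝ, 0 ≤ B ∧ ∀ c, ∀ y ∈ cube (0 : Rn n) 1, |polyEval (F c) y| ≤ B * ‖c‖ := by
    choose b hb using fun j => (isCompact_cube (0 : Rn n) 1).exists_bound_of_continuousOn
      (continuous_polyEval (F (Pi.single j 1))).continuousOn
    refine ⟨∑ j, |b j|, by positivity, fun c y hy => ?_⟩
    rw [heval, Finset.sum_mul]
    refine (Finset.abs_sum_le_sum_abs _ _).trans (Finset.sum_le_sum fun j _ => ?_)
    rw [abs_mul, mul_comm]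
    exact mul_le_mul ((hb j y hy).trans (le_abs_self _)) (norm_le_pi_norm c j) (abs_nonneg _)
      (abs_nonneg _)
  obtain ⟨B, hB0, hB⟩ := hsup
  have hmem : ∀ x y : Rn n, ∀ r, 0 < r → y ∈ cube x r → r⁻¹ • (y - x) ∈ cube (0 : Rn n) 1 := by
    intro x y r hr hy i
    have := hy i
    simp only [PiLp.smul_apply, PiLp.sub_apply, PiLp.zero_apply, sub_zero, smul_eq_mul, abs_mul,
      abs_inv, abs_of_pos hr]
    rwa [inv_mul_le_iff₀ hr, mul_one]
  -- a threshold for sublevel sets that serves all coordinate vectors of norm one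
  obtain ⟨η, hη, hsub⟩ : ∃ η : ℝ, 0 < η ∧ ∀ c ∈ Metric.sphere (0 : Fin N → ℝ) 1, ∀ x : Rn n, ∀ r,
      0 < r → r ≤ R → μ {y ∈ cube x r | |polyEval (F c) (r⁻¹ • (y - x))| < η} ≤
        ENNReal.ofReal (c₁ / 2 * r ^ s) := by
    refine (isCompact_sphere (0 : Fin N → ℝ) 1).induction_on
      (p := fun A => ∃ η : ℝ, 0 < η ∧ ∀ c ∈ A, ∀ x : Rn n, ∀ r,
        0 < r → r ≤ R → μ {y ∈ cube x r | |polyEval (F c) (r⁻¹ • (y - x))| < η} ≤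
        ENNReal.ofReal (c₁ / 2 * r ^ s)) ⟨1, one_pos, by simp⟩ ?_ ?_ ?_
    · rintro A A' hAA' ⟨η, hη, hA⟩
      exact ⟨η, hη, fun c hc => hA c (hAA' hc)⟩
    · rintro A A' ⟨η, hη, hA⟩ ⟨η', hη', hA'⟩
      refine ⟨min η η', lt_min hη hη', fun c hc x r hr hrR => ?_⟩
      rcases hc with hc | hc
      · refine (measure_mono fun y hy => ?_).trans (hA c hc x r hr hrR)
        exact ⟨hy.1, hy.2.trans_le (min_le_left _ _)⟩
      · refine (measure_mono fun y hy => ?_).trans (hA' c hc x r hr hrR)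
        exact ⟨hy.1, hy.2.trans_le (min_le_right _ _)⟩
    · intro c hc
      have hc0 : F c ≠ 0 := by
        intro h0
        have : c = 0 := hinj (h0.trans (map_zero F).symm)
        rw [this] at hc; simp at hc
      obtain ⟨η, hη, hle⟩ := h.measure_sublevel_le hn hs₀ hs hc0 (half_pos hc₁)
      refine ⟨Metric.ball c (η / 2 / (B + 1)),
        mem_nhdsWithin_of_mem_nhds (Metric.ball_mem_nhds c (by positivity)), η / 2, by positivity,
        fun c' hc' x r hr hrR => (measure_mono ?_).trans (hle x r hr hrR)⟩
      rintro y ⟨hy, hyη⟩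
      refine ⟨hy, ?_⟩
      have h1 := hB (c - c') _ (hmem x y r hr hy)
      rw [map_sub, polyEval_sub] at h1
      have h2 : B * ‖c - c'‖ ≤ η / 2 := by
        rw [Metric.mem_ball, dist_comm, dist_eq_norm, lt_div_iff₀ (by positivity)] at hc'
        nlinarith [norm_nonneg (c - c')]
      have h3 := abs_sub_abs_le_abs_sub (polyEval (F c) (r⁻¹ • (y - x)))
        (polyEval (F c') (r⁻¹ • (y - x)))
      linarith
  have hκ : 0 < 2 * c₂ / (η * c₁) := by positivity
  refine ⟨N, F, (2 * c₂ / (η * c₁)).toNNReal, B.toNNReal, hdeg, hsurj, ?_, ?_⟩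
  · intro c x r hr y hy
    have h1 := hB c _ (hmem x y r hr hy)
    rw [← ofReal_norm, ← ofReal_norm, ← ENNReal.ofReal, ← ENNReal.ofReal_mul hB0]
    exact ENNReal.ofReal_le_ofReal h1
  · intro c x hx r hr hrR
    by_cases hc : c = 0
    · simp [hc]
    have hc' : 0 < ‖c‖ := norm_pos_iff.2 hc
    set G : Set (Rn n) :=
      {y ∈ cube x r | |polyEval (F (‖c‖⁻¹ • c)) (r⁻¹ • (y - x))| < η} with hG
    have hcont : Continuous fun y : Rn n => |polyEval (F (‖c‖⁻¹ • c)) (r⁻¹ • (y - x))| :=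
      ((continuous_polyEval _).comp (by fun_prop)).abs
    have hGm : MeasurableSet G :=
      (measurableSet_cube x r).inter (isOpen_lt hcont continuous_const).measurableSet
    have hGle : μ G ≤ ENNReal.ofReal (c₁ / 2 * r ^ s) :=
      hsub _ (by simp [norm_smul, hc'.ne']) x r hr hrR
    have hGsub : G ⊆ cube x r := fun y hy => hy.1
    have hdiff : ENNReal.ofReal (c₁ / 2 * r ^ s) ≤ μ (cube x r \ G) := by
      rw [measure_sdiff hGsub hGm.nullMeasurableSet (hGle.trans_lt ENNReal.ofReal_lt_top).ne]
      refine le_trans ?_ (tsub_le_tsub (h.lower x hx r hr hrR) hGle)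
      rw [← ENNReal.ofReal_sub _ (by positivity)]
      apply ENNReal.ofReal_le_ofReal
      linarith
    have hlow : ∀ y ∈ cube x r \ G,
        ENNReal.ofReal (η * ‖c‖) ≤ ‖polyEval (F c) (r⁻¹ • (y - x))‖ₑ := by
      rintro y ⟨hy, hyG⟩
      have h1 : η ≤ |polyEval (F (‖c‖⁻¹ • c)) (r⁻¹ • (y - x))| :=
        not_lt.1 fun hlt => hyG ⟨hy, hlt⟩
      rw [← ofReal_norm, Real.norm_eq_abs]
      apply ENNReal.ofReal_le_ofReal
      rw [map_smul, polyEval, MvPolynomial.smul_eval, abs_mul, abs_inv, abs_norm,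
        inv_mul_eq_div, le_div_iff₀ hc'] at h1
      exact h1
    have hint : ENNReal.ofReal (η * ‖c‖) * ENNReal.ofReal (c₁ / 2 * r ^ s) ≤
        ∫⁻ y in cube x r, ‖polyEval (F c) (r⁻¹ • (y - x))‖ₑ ∂μ := by
      calc _ ≤ ENNReal.ofReal (η * ‖c‖) * μ (cube x r \ G) := by gcongr
        _ = ∫⁻ _ in cube x r \ G, ENNReal.ofReal (η * ‖c‖) ∂μ := (setLIntegral_const _ _).symm
        _ ≤ ∫⁻ y in cube x r \ G, ‖polyEval (F c) (r⁻¹ • (y - x))‖ₑ ∂μ :=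
          setLIntegral_mono' ((measurableSet_cube x r).diff hGm) hlow
        _ ≤ _ := lintegral_mono_set sdiff_subset
    have hrs : 0 < r ^ s := Real.rpow_pos_of_pos hr s
    calc ‖c‖ₑ = ENNReal.ofReal (2 * c₂ / (η * c₁)) *
          (ENNReal.ofReal (η * ‖c‖) * ENNReal.ofReal (c₁ / 2 * r ^ s) /
            ENNReal.ofReal (c₂ * r ^ s)) := by
          rw [← ENNReal.ofReal_mul (by positivity), ← ENNReal.ofReal_div_of_pos (by positivity),
            ← ENNReal.ofReal_mul (by positivity), ← ofReal_norm]
          congr 1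
          field_simp
      _ ≤ _ := by
        rw [setLAverage_eq]
        have := h.upper x r hr hrR
        exact mul_le_mul' le_rfl (ENNReal.div_le_div hint this)

end IsRegular

/-! ### The Remez type inequality and best approximation -/

theorem enorm_sub_le_add (a b c : ℝ) : ‖a - c‖ₑ ≤ ‖a - b‖ₑ + ‖b - c‖ₑ := by
  calc ‖a - c‖ₑ = ‖(a - b) + (b - c)‖ₑ := by rw [sub_add_sub_cancel]
    _ ≤ _ := enorm_add_le _ _

theorem enorm_sub_comm' (a b : ℝ) : ‖a - b‖ₑ = ‖b - a‖ₑ := by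
  rw [← enorm_neg, neg_sub]

theorem aemeasurable_enorm_sub_polyEval {μ : Measure (Rn n)} {f : Rn n → ℝ} (hf : AEMeasurable f μ)
    (P : MvPolynomial (Fin n) ℝ) : AEMeasurable (fun y => ‖f y - polyEval P y‖ₑ) μ :=
  (hf.sub (continuous_polyEval P).measurable.aemeasurable).enorm

theorem polyEval_rescale (x : Rn n) {r : ℝ} (hr : r ≠ 0) (P : MvPolynomial (Fin n) ℝ) (y : Rn n) :
    polyEval (affineComp x r P) (r⁻¹ • (y - x)) = polyEval P y := by
  rw [polyEval_affineComp, smul_inv_smul₀ hr, add_sub_cancel]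

theorem polyEval_rescale_inv (x : Rn n) {r : ℝ} (P : MvPolynomial (Fin n) ℝ)
    (y : Rn n) : polyEval (affineComp (-(r⁻¹ • x)) r⁻¹ P) y = polyEval P (r⁻¹ • (y - x)) := by
  rw [polyEval_affineComp, smul_sub, neg_add_eq_sub]

namespace IsRegular

variable {μ : Measure (Rn n)} {T : Set (Rn n)} {s R c₁ c₂ : ℝ} {K : ℝ≥0}

/-- A Remez type inequality: on a cube centred on `T`, a polynomial is bounded by a constant times
its `μ`-average. -/
theorem exists_polynomial_le_average (h : IsRegular μ T s R c₁ c₂ K) (hn : 1 ≤ n) (hs₀ : 0 < s)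
    (hs : (n : ℝ) - 1 < s) (d : ℕ) :
    ∃ C : ℝ≥0, ∀ x ∈ T, ∀ r, 0 < r → r ≤ R → ∀ P : MvPolynomial (Fin n) ℝ, P.totalDegree ≤ d →
      ∀ y ∈ cube x r, ‖polyEval P y‖ₑ ≤ C * ⨍⁻ z in cube x r, ‖polyEval P z‖ₑ ∂μ := by
  obtain ⟨N, F, A, B, -, hsurj, hB, hA⟩ := h.exists_coordinates hn hs₀ hs d
  refine ⟨B * A, fun x hx r hr hrR P hP y hy => ?_⟩
  obtain ⟨c, hc⟩ := hsurj _ (totalDegree_affineComp_le x r hP)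
  have h1 := hB c x r hr y hy
  have h2 := hA c x hx r hr hrR
  simp only [hc, polyEval_rescale x hr.ne'] at h1 h2
  calc _ ≤ _ := h1
    _ ≤ _ := by rw [ENNReal.coe_mul, mul_assoc]; gcongr

/-- Best approximations in the mean by polynomials of degree at most `d` exist. -/
theorem exists_best_approximation (h : IsRegular μ T s R c₁ c₂ K) (hn : 1 ≤ n) (hs₀ : 0 < s)
    (hs : (n : ℝ) - 1 < s) (d : ℕ) {f : Rn n → ℝ} (hf : AEMeasurable f μ) {x : Rn n} (hx : x ∈ T)
    {r : ℝ} (hr : 0 < r) (hrR : r ≤ R) (hint : ∫⁻ y in cube x r, ‖f y‖ₑ ∂μ ≠ ∞) :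
    ∃ P : MvPolynomial (Fin n) ℝ, P.totalDegree ≤ d ∧
      ∀ P' : MvPolynomial (Fin n) ℝ, P'.totalDegree ≤ d →
        ⨍⁻ y in cube x r, ‖f y - polyEval P y‖ₑ ∂μ ≤
          ⨍⁻ y in cube x r, ‖f y - polyEval P' y‖ₑ ∂μ := by
  obtain ⟨N, F, A, B, hdeg, hsurj, hB, hA⟩ := h.exists_coordinates hn hs₀ hs d
  have hQ := measurableSet_cube x r
  set φ : (Fin N → ℝ) → Rn n → ℝ := fun c y => polyEval (F c) (r⁻¹ • (y - x)) with hφ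
  have hφm : ∀ c, Measurable (φ c) := fun c =>
    ((continuous_polyEval (F c)).comp (by fun_prop)).measurable
  have hφsub : ∀ c c' y, φ (c - c') y = φ c y - φ c' y := fun c c' y => by
    simp only [hφ, map_sub, polyEval_sub]
  set a : (Fin N → ℝ) → ℝ≥0∞ := fun c => ⨍⁻ y in cube x r, ‖f y - φ c y‖ₑ ∂μ with ha
  have hcont : Continuous a := by
    refine continuous_of_le_add_edist B (by simp) fun c c' => ?_
    calc a c ≤ a c' + ⨍⁻ _ in cube x r, B * ‖c - c'‖ₑ ∂μ := by
          refine setLAverage_add_le hQ (hf.sub (hφm c').aemeasurable).enorm fun y hy => ?_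
          refine (enorm_sub_le_add _ (φ c' y) _).trans (add_le_add le_rfl ?_)
          rw [enorm_sub_comm', ← hφsub]
          exact hB _ x r hr y hy
      _ ≤ a c' + B * ‖c - c'‖ₑ := by gcongr; exact setLAverage_const_le _ _
      _ = _ := by rw [edist_eq_enorm_sub]
  have hm : ⨍⁻ y in cube x r, ‖f y‖ₑ ∂μ ≠ ∞ := h.setLAverage_ne_top hx hr hint
  set m := ⨍⁻ y in cube x r, ‖f y‖ₑ ∂μ with hmdef
  have ha0 : a 0 = m := by simp [ha, hφ, polyEval_zero, hmdef]
  have hM : A * (m + m) ≠ ∞ := ENNReal.mul_ne_top (by simp) (by simp [hm])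
  obtain ⟨c₀, -, hmin⟩ := (isCompact_closedBall (0 : Fin N → ℝ)
    (A * (m + m)).toReal).exists_isMinOn
      ⟨0, Metric.mem_closedBall_self ENNReal.toReal_nonneg⟩ hcont.continuousOn
  have hglobal : ∀ c, a c₀ ≤ a c := by
    intro c
    by_cases hc : c ∈ Metric.closedBall (0 : Fin N → ℝ) (A * (m + m)).toReal
    · exact hmin hc
    have h0 : a c₀ ≤ a 0 := hmin (Metric.mem_closedBall_self ENNReal.toReal_nonneg)
    -- outside the ball, the zero polynomial does better
    by_contra! hlt
    apply hc
    have h1 : a c ≤ m := hlt.le.trans (h0.trans_eq ha0)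
    have h2 : ⨍⁻ y in cube x r, ‖φ c y‖ₑ ∂μ ≤ m + a c :=
      setLAverage_add_le hQ hf.enorm fun y _ => by
        have := enorm_sub_le_add (φ c y) (f y) 0
        rw [sub_zero, sub_zero, enorm_sub_comm', add_comm] at this
        exact this
    have h3 : ‖c‖ₑ ≤ A * (m + m) := (hA c x hx r hr hrR).trans (by gcongr; exact h2.trans (by gcongr))
    rw [mem_closedBall_zero_iff, ← toReal_enorm]
    exact ENNReal.toReal_mono hM h3
  refine ⟨affineComp (-(r⁻¹ • x)) r⁻¹ (F c₀), totalDegree_affineComp_le _ _ (hdeg _),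
    fun P' hP' => ?_⟩
  obtain ⟨c, hc⟩ := hsurj _ (totalDegree_affineComp_le x r hP')
  have := hglobal c
  simp only [ha, hφ, hc, polyEval_rescale x hr.ne'] at this
  simpa only [polyEval_rescale_inv] using this

end IsRegular

/-! ### Pointwise approximation at Lebesgue points -/

namespace IsRegular

variable {μ : Measure (Rn n)} {T : Set (Rn n)} {s R c₁ c₂ : ℝ} {K : ℝ≥0}

/-- Lebesgue's differentiation theorem for averages over cubes, deduced from the one for Euclidean
balls. -/
theorem ae_tendsto_average (h : IsRegular μ T s R c₁ c₂ K) (hn : 1 ≤ n) {f : Rn n → ℝ}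
    (hf : LocallyIntegrable f μ) :
    ∀ᵐ x ∂μ, Tendsto (fun t => ⨍⁻ y in cube x t, ‖f y - f x‖ₑ ∂μ) (𝓝[>] 0) (𝓝 0) := by
  obtain ⟨hR, hc₁, hc₂⟩ := h.pos
  have := h.isLocallyFiniteMeasure
  have hn0 : (0 : ℝ) < n := by exact_mod_cast hn
  filter_upwards [h.ae_mem, (Besicovitch.vitaliFamily μ).ae_tendsto_lintegral_enorm_sub_div hf]
    with x hx hlim
  have hscale : Tendsto (fun t : ℝ => (n : ℝ) * t) (𝓝[>] 0) (𝓝[>] 0) := by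
    refine tendsto_nhdsWithin_iff.2 ⟨?_, ?_⟩
    · have : Tendsto (fun t : ℝ => (n : ℝ) * t) (𝓝 0) (𝓝 (n * 0)) := by
        exact (continuous_const.mul continuous_id).tendsto 0
      rw [mul_zero] at this
      exact this.mono_left nhdsWithin_le_nhds
    · filter_upwards [self_mem_nhdsWithin] with t ht
      exact mul_pos hn0 ht
  have hball := hlim.comp ((Besicovitch.tendsto_filterAt μ x).comp hscale)
  set κ : ℝ := c₂ * n ^ s / c₁ with hκ
  have hbound := ENNReal.Tendsto.const_mul (a := ENNReal.ofReal κ) hball (Or.inr (by simp))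
  rw [mul_zero] at hbound
  refine tendsto_of_tendsto_of_tendsto_of_le_of_le' tendsto_const_nhds hbound
    (Eventually.of_forall fun _ => bot_le) ?_
  have hsmall : ∀ᶠ t in 𝓝[>] (0 : ℝ), t ≤ R / n :=
    mem_nhdsWithin_of_mem_nhds (Iic_mem_nhds (by positivity))
  filter_upwards [self_mem_nhdsWithin, hsmall] with t ht htR
  have ht0 : 0 < t := ht
  have htR' : n * t ≤ R := by rw [le_div_iff₀ hn0] at htR; linarith
  have htR'' : t ≤ R := by
    have : (1 : ℝ) ≤ n := by exact_mod_cast hn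
    nlinarith
  have hle : μ (Metric.closedBall x (n * t)) ≤ ENNReal.ofReal κ * μ (cube x t) := by
    calc μ (Metric.closedBall x (n * t)) ≤ μ (cube x (n * t)) :=
          measure_mono (closedBall_subset_cube _ _)
      _ ≤ ENNReal.ofReal (c₂ * (n * t) ^ s) := h.upper _ _ (by positivity) htR'
      _ = ENNReal.ofReal κ * ENNReal.ofReal (c₁ * t ^ s) := by
        rw [← ENNReal.ofReal_mul (by positivity), Real.mul_rpow hn0.le ht0.le]
        congr 1
        rw [hκ]; field_simp
      _ ≤ _ := by gcongr; exact h.lower x hx t ht0 htR''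
  have := setLAverage_le_of_subset (cube_subset_closedBall x ht0.le)
    (h.measure_cube_pos hx ht0).ne' hle
    (((measure_mono (closedBall_subset_cube _ _)).trans_lt (h.finite x _)).ne)
    (fun y => ‖f y - f x‖ₑ)
  rwa [setLAverage_eq μ _ (Metric.closedBall x (n * t))] at this

/-- At a Lebesgue point `x`, approximation of order `α` on all small cubes around `x` controls the
distance from `f x` to the approximating polynomials at `x`: these converge to `f x` as the cubes
shrink, and consecutive ones on dyadic cubes are close by the Remez type inequality. -/
theorem exists_pointwise_bound (h : IsRegular μ T s R c₁ c₂ K) (hn : 1 ≤ n) (hs₀ : 0 < s)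
    (hs : (n : ℝ) - 1 < s) (d : ℕ) {α : ℝ} (hα : 0 < α) :
    ∃ C : ℝ≥0, ∀ f : Rn n → ℝ, AEMeasurable f μ → ∀ x ∈ T,
      Tendsto (fun t => ⨍⁻ y in cube x t, ‖f y - f x‖ₑ ∂μ) (𝓝[>] 0) (𝓝 0) →
      ∀ (M : ℝ≥0∞) (P : ℝ → MvPolynomial (Fin n) ℝ),
        (∀ t, 0 < t → t ≤ R → (P t).totalDegree ≤ d ∧
          ⨍⁻ y in cube x t, ‖f y - polyEval (P t) y‖ₑ ∂μ ≤ ENNReal.ofReal (t ^ α) * M) →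
        ∀ t, 0 < t → t ≤ R → ‖f x - polyEval (P t) x‖ₑ ≤ C * ENNReal.ofReal (t ^ α) * M := by
  obtain ⟨C₀, hC₀⟩ := h.exists_polynomial_le_average hn hs₀ hs d
  set q : ℝ := (1 / 2 : ℝ) ^ α with hq
  have hq0 : 0 < q := by positivity
  have hq1 : q < 1 := Real.rpow_lt_one (by norm_num) (by norm_num) hα
  have hq1' : ENNReal.ofReal q < 1 := by
    rw [← ENNReal.ofReal_one]; exact (ENNReal.ofReal_lt_ofReal_iff one_pos).2 hq1
  have hgeom : (1 - ENNReal.ofReal q)⁻¹ ≠ ∞ :=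
    ENNReal.inv_ne_top.2 (tsub_pos_of_lt hq1').ne'
  refine ⟨C₀ * (1 + K) * (1 - ENNReal.ofReal q)⁻¹.toNNReal + 1, ?_⟩
  intro f hf x hx hleb M P hP t ht htR
  have htα : 0 < t ^ α := by positivity
  by_cases hM : M = ∞
  · have : ((C₀ * (1 + K) * (1 - ENNReal.ofReal q)⁻¹.toNNReal + 1 : ℝ≥0) : ℝ≥0∞) *
        ENNReal.ofReal (t ^ α) ≠ 0 :=
      mul_ne_zero (by simp) (ENNReal.ofReal_pos.2 htα).ne'
    rw [hM, ENNReal.mul_top this]; exact le_top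
  set τ : ℕ → ℝ := fun j => t * (1 / 2) ^ j with hτ
  have hτ0 : ∀ j, 0 < τ j := fun j => by positivity
  have hτR : ∀ j, τ j ≤ R := fun j => le_trans (by
    have : ((1 : ℝ) / 2) ^ j ≤ 1 := pow_le_one₀ (by norm_num) (by norm_num)
    simp only [hτ]; nlinarith) htR
  have hτs : ∀ j, τ j = 2 * τ (j + 1) := fun j => by simp only [hτ, pow_succ]; ring
  have hτα : ∀ j, ENNReal.ofReal (τ j ^ α) = ENNReal.ofReal (t ^ α) * ENNReal.ofReal q ^ j := by
    intro j
    rw [← ENNReal.ofReal_pow hq0.le, ← ENNReal.ofReal_mul htα.le, hq, Real.rpow_pow_comm (by norm_num),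
      ← Real.mul_rpow ht.le (by positivity)]
  have hdec : ∀ j, ENNReal.ofReal (τ (j + 1) ^ α) ≤ ENNReal.ofReal (τ j ^ α) := fun j => by
    apply ENNReal.ofReal_le_ofReal
    refine Real.rpow_le_rpow (hτ0 _).le ?_ hα.le
    rw [hτs j]; linarith [hτ0 (j + 1)]
  have hQ : ∀ j, MeasurableSet (cube x (τ j)) := fun j => measurableSet_cube _ _
  have hmeas : ∀ j, AEMeasurable (fun y => ‖f y - polyEval (P (τ j)) y‖ₑ) μ :=
    fun j => aemeasurable_enorm_sub_polyEval hf _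
  have havg : ∀ j, ⨍⁻ y in cube x (τ j), ‖f y - polyEval (P (τ j)) y‖ₑ ∂μ ≤
      ENNReal.ofReal (τ j ^ α) * M := fun j => (hP _ (hτ0 j) (hτR j)).2
  have hdeg : ∀ j, (P (τ j)).totalDegree ≤ d := fun j => (hP _ (hτ0 j) (hτR j)).1
  -- consecutive approximations
  have hstep : ∀ j, ‖polyEval (P (τ (j + 1))) x - polyEval (P (τ j)) x‖ₑ ≤
      C₀ * (1 + K) * (ENNReal.ofReal (t ^ α) * M) * ENNReal.ofReal q ^ j := by
    intro j
    have h1 := hC₀ x hx _ (hτ0 (j + 1)) (hτR _) (P (τ (j + 1)) - P (τ j))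
      ((MvPolynomial.totalDegree_sub _ _).trans (max_le (hdeg _) (hdeg _))) x
      (mem_cube_self x (hτ0 _).le)
    have h2 : ⨍⁻ y in cube x (τ (j + 1)), ‖polyEval (P (τ (j + 1)) - P (τ j)) y‖ₑ ∂μ ≤
        ⨍⁻ y in cube x (τ (j + 1)), ‖f y - polyEval (P (τ (j + 1))) y‖ₑ ∂μ +
        ⨍⁻ y in cube x (τ (j + 1)), ‖f y - polyEval (P (τ j)) y‖ₑ ∂μ := by
      refine setLAverage_add_le (hQ _) (hmeas _) fun y _ => ?_
      rw [polyEval_sub, enorm_sub_comm' (f y) (polyEval (P (τ (j + 1))) y)]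
      exact enorm_sub_le_add _ _ _
    have h3 : ⨍⁻ y in cube x (τ (j + 1)), ‖f y - polyEval (P (τ j)) y‖ₑ ∂μ ≤
        K * ⨍⁻ y in cube x (τ j), ‖f y - polyEval (P (τ j)) y‖ₑ ∂μ := by
      refine setLAverage_le_of_subset (cube_mono x ?_) (h.measure_cube_pos hx (hτ0 _)).ne' ?_
        (h.finite x _).ne _
      · rw [hτs j]; linarith [hτ0 (j + 1)]
      · rw [hτs j]; exact h.doubling x hx _ (hτ0 _)
    rw [polyEval_sub] at h1
    calc _ ≤ _ := h1
      _ ≤ C₀ * (ENNReal.ofReal (τ j ^ α) * M + K * (ENNReal.ofReal (τ j ^ α) * M)) := by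
        gcongr
        refine h2.trans (add_le_add ((havg _).trans ?_) (h3.trans ?_))
        · gcongr ?_ * M; exact hdec j
        · gcongr; exact havg j
      _ = _ := by rw [hτα]; ring
  -- convergence to `f x`
  have hτlim : Tendsto τ atTop (𝓝[>] 0) := by
    refine tendsto_nhdsWithin_iff.2 ⟨?_, Eventually.of_forall hτ0⟩
    have := (tendsto_pow_atTop_nhds_zero_of_lt_one (r := (1 : ℝ) / 2) (by norm_num)
      (by norm_num)).const_mul t
    rwa [mul_zero] at this
  have hconv : Tendsto (fun j => ‖f x - polyEval (P (τ j)) x‖ₑ) atTop (𝓝 0) := by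
    have hb : ∀ j, ‖f x - polyEval (P (τ j)) x‖ₑ ≤
        C₀ * (ENNReal.ofReal (t ^ α) * M * ENNReal.ofReal q ^ j +
          ⨍⁻ y in cube x (τ j), ‖f y - f x‖ₑ ∂μ) := by
      intro j
      have h1 := hC₀ x hx _ (hτ0 j) (hτR _) (MvPolynomial.C (f x) - P (τ j))
        ((MvPolynomial.totalDegree_sub _ _).trans (max_le (by simp) (hdeg _))) x
        (mem_cube_self x (hτ0 _).le)
      have hCe : ∀ y, polyEval (MvPolynomial.C (f x) - P (τ j)) y = f x - polyEval (P (τ j)) y :=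
        fun y => by rw [polyEval_sub]; simp [polyEval]
      simp only [hCe] at h1
      refine h1.trans ?_
      gcongr
      calc _ ≤ ⨍⁻ y in cube x (τ j), ‖f y - polyEval (P (τ j)) y‖ₑ ∂μ +
            ⨍⁻ y in cube x (τ j), ‖f y - f x‖ₑ ∂μ := by
              refine setLAverage_add_le (hQ _) (hmeas _) fun y _ => ?_
              rw [add_comm, enorm_sub_comm' (f y) (f x)]
              exact enorm_sub_le_add _ _ _
        _ ≤ _ := by
          gcongr
          refine (havg j).trans_eq ?_
          rw [hτα]; ring
    refine tendsto_of_tendsto_of_tendsto_of_le_of_le tendsto_const_nhds ?_ (fun _ => bot_le) hb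
    have h1 : Tendsto (fun j => ENNReal.ofReal (t ^ α) * M * ENNReal.ofReal q ^ j) atTop (𝓝 0) := by
      have := ENNReal.Tendsto.const_mul (a := ENNReal.ofReal (t ^ α) * M)
        (ENNReal.tendsto_pow_atTop_nhds_zero_of_lt_one hq1')
        (Or.inr (ENNReal.mul_ne_top ENNReal.ofReal_ne_top hM))
      rwa [mul_zero] at this
    have h2 := ENNReal.Tendsto.const_mul (a := (C₀ : ℝ≥0∞)) (h1.add (hleb.comp hτlim))
      (Or.inr ENNReal.coe_ne_top)
    rw [add_zero, mul_zero] at h2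
    exact h2
  -- summation of the telescoping series
  have hsum : ∀ j, ‖f x - polyEval (P (τ 0)) x‖ₑ ≤ ‖f x - polyEval (P (τ j)) x‖ₑ +
      ∑ i ∈ Finset.range j, C₀ * (1 + K) * (ENNReal.ofReal (t ^ α) * M) * ENNReal.ofReal q ^ i := by
    intro j
    induction j with
    | zero => simp
    | succ j ih =>
      refine ih.trans ?_
      rw [Finset.sum_range_succ, add_comm (∑ i ∈ Finset.range j, _), ← add_assoc]
      gcongr
      exact (enorm_sub_le_add _ (polyEval (P (τ (j + 1))) x) _).trans (add_le_add le_rfl (hstep j))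
  have hτ00 : τ 0 = t := by simp [hτ]
  have hfin : ∀ j, ‖f x - polyEval (P t) x‖ₑ ≤ ‖f x - polyEval (P (τ j)) x‖ₑ +
      C₀ * (1 + K) * (ENNReal.ofReal (t ^ α) * M) * (1 - ENNReal.ofReal q)⁻¹ := by
    intro j
    rw [← hτ00]
    refine (hsum j).trans ?_
    rw [hτ00]
    gcongr
    rw [← Finset.mul_sum, ← ENNReal.tsum_geometric]
    gcongr
    exact ENNReal.sum_le_tsum _
  have hlim := ge_of_tendsto' (hconv.add_const
    (C₀ * (1 + K) * (ENNReal.ofReal (t ^ α) * M) * (1 - ENNReal.ofReal q)⁻¹)) hfin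
  rw [zero_add] at hlim
  refine hlim.trans ?_
  push_cast
  rw [ENNReal.coe_toNNReal hgeom]
  calc _ = (C₀ * (1 + K) * (1 - ENNReal.ofReal q)⁻¹) * ENNReal.ofReal (t ^ α) * M := by ring
    _ ≤ _ := by gcongr; exact le_self_add

end IsRegular

/-! ### Piecewise polynomial approximation on nets -/

/-- The index of the cube of the net with base point `a` and mesh size `r` that contains `y`. -/
noncomputable def netIndex (a : Rn n) (r : ℝ) (y : Rn n) : Fin n → ℤ :=
  fun i => ⌊(y i - a i) / r⌋

theorem mem_netCube_iff {a : Rn n} {r : ℝ} (hr : 0 < r) {m : Fin n → ℤ} {y : Rn n} :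
    y ∈ netCube a r m ↔ netIndex a r y = m := by
  simp only [netCube, netIndex, mem_ofPred_eq, funext_iff, Int.floor_eq_iff, le_div_iff₀ hr,
    div_lt_iff₀ hr]
  refine forall_congr' fun i => ?_
  constructor <;> rintro ⟨h1, h2⟩ <;> constructor <;> linarith

theorem mem_netCube_netIndex (a : Rn n) {r : ℝ} (hr : 0 < r) (y : Rn n) :
    y ∈ netCube a r (netIndex a r y) :=
  (mem_netCube_iff hr).2 rfl

theorem mem_cube_of_mem_netCube {a : Rn n} {r : ℝ} {m : Fin n → ℤ} {x y : Rn n}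
    (hx : x ∈ netCube a r m) (hy : y ∈ netCube a r m) : y ∈ cube x r := by
  intro i
  rw [abs_le]
  have h1 := hx i
  have h2 := hy i
  constructor <;> linarith

theorem localApprox_le_of_totalDegree {s : ℝ} {S : Set (Rn n)} {α : ℝ} (hα : 0 ≤ α)
    (hα' : ∀ m : ℤ, α ≠ m) {f : Rn n → ℝ} {Q : Set (Rn n)} {P : MvPolynomial (Fin n) ℝ}
    (hP : P.totalDegree ≤ ⌊α⌋₊) :
    localApprox s S ⌈α⌉₊ f Q ≤ ⨍⁻ y in Q, ‖f y - polyEval P y‖ₑ ∂(measureOn s S) := by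
  refine iInf₂_le P (Or.inr (hP.trans_lt ?_))
  -- for an integer `α`, the floor and the ceiling would agree
  rw [Nat.lt_ceil]
  exact lt_of_le_of_ne (Nat.floor_le hα) fun h => hα' ⌊α⌋₊ (by rw [Int.cast_natCast]; exact h.symm)

theorem localApprox_le_sharpMaximal {s : ℝ} {S : Set (Rn n)} {α : ℝ} {f : Rn n → ℝ} {x : Rn n}
    {t : ℝ} (ht : 0 < t) :
    localApprox s S ⌈α⌉₊ f (cube x t) ≤ ENNReal.ofReal (t ^ α) * sharpMaximal s S α f x := by
  have h1 : ENNReal.ofReal (t ^ (-α)) * localApprox s S ⌈α⌉₊ f (cube x t) ≤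
      sharpMaximal s S α f x := le_iSup₂ (f := fun (t : ℝ) (_ : 0 < t) =>
        ENNReal.ofReal (t ^ (-α)) * localApprox s S ⌈α⌉₊ f (cube x t)) t ht
  calc localApprox s S ⌈α⌉₊ f (cube x t)
      = ENNReal.ofReal (t ^ α) *
        (ENNReal.ofReal (t ^ (-α)) * localApprox s S ⌈α⌉₊ f (cube x t)) := by
        rw [← mul_assoc, ← ENNReal.ofReal_mul (by positivity), ← Real.rpow_add ht, add_neg_cancel,
          Real.rpow_zero, ENNReal.ofReal_one, one_mul]
    _ ≤ _ := by gcongr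

namespace IsRegular

variable {T : Set (Rn n)} {s c₁ c₂ : ℝ} {K : ℝ≥0} {S : Set (Rn n)}

/-- For every net of mesh size `r ≤ 1`, a function is approximated by a piecewise polynomial with
pointwise error at most a constant times `r ^ α` times its sharp maximal function. On each net cube
that meets `T`, the polynomial is a best approximation on a larger cube centred on `T`. -/
theorem exists_piecewisePoly (h : IsRegular (measureOn s S) T s 3 c₁ c₂ K) (hn : 1 ≤ n)
    (hs₀ : 0 < s) (hs : (n : ℝ) - 1 < s) {α : ℝ} (hα : 0 < α) :
    ∃ C : ℝ≥0, ∀ f : Rn n → ℝ, LocallyIntegrable f (measureOn s S) →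
      ∀ r, 0 < r → r ≤ 1 → ∀ a, ∃ g, IsPiecewisePoly ⌊α⌋₊ a r g ∧
        ∀ᵐ x ∂(measureOn s S),
          ‖f x - g x‖ₑ ≤ C * ENNReal.ofReal (r ^ α) * sharpMaximal s S α f x := by
  set μ := measureOn s S
  obtain ⟨C₀, hC₀⟩ := h.exists_polynomial_le_average hn hs₀ hs ⌊α⌋₊
  obtain ⟨C₁, hC₁⟩ := h.exists_pointwise_bound hn hs₀ hs ⌊α⌋₊ hα
  refine ⟨(C₁ + 2 * C₀ * K) * (3 ^ α : ℝ).toNNReal, fun f hf r hr hr1 a => ?_⟩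
  have hfm : AEMeasurable f μ := hf.aestronglyMeasurable.aemeasurable
  have hfint : ∀ x t, ∫⁻ y in cube x t, ‖f y‖ₑ ∂μ ≠ ∞ := fun x t =>
    (hf.integrableOn_isCompact (isCompact_cube x t)).2.ne
  have hbest : ∀ x ∈ T, ∀ t, 0 < t → t ≤ 3 → ∃ P : MvPolynomial (Fin n) ℝ, P.totalDegree ≤ ⌊α⌋₊ ∧
      ∀ P' : MvPolynomial (Fin n) ℝ, P'.totalDegree ≤ ⌊α⌋₊ →
        ⨍⁻ y in cube x t, ‖f y - polyEval P y‖ₑ ∂μ ≤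
          ⨍⁻ y in cube x t, ‖f y - polyEval P' y‖ₑ ∂μ := fun x hx t ht htR =>
    h.exists_best_approximation hn hs₀ hs _ hfm hx ht htR (hfint x t)
  choose! P hPdeg hPbest using hbest
  classical
  let G : (Fin n → ℤ) → MvPolynomial (Fin n) ℝ := fun m =>
    if hm : (netCube a r m ∩ T).Nonempty then P hm.some (2 * r) else 0
  refine ⟨fun y => polyEval (G (netIndex a r y)) y, fun m => ⟨G m, ?_, fun y hy => ?_⟩, ?_⟩
  · by_cases hm : (netCube a r m ∩ T).Nonempty
    · simp only [G, dif_pos hm]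
      exact hPdeg _ hm.some_mem.2 _ (by positivity) (by linarith)
    · simp [G, dif_neg hm]
  · simp only [(mem_netCube_iff hr).1 hy]
  filter_upwards [h.ae_mem, h.ae_tendsto_average hn hf] with x hx hleb
  have hm : (netCube a r (netIndex a r x) ∩ T).Nonempty := ⟨x, mem_netCube_netIndex a hr x, hx⟩
  simp only [G, dif_pos hm]
  obtain ⟨hz, hzT⟩ := hm.some_mem
  set z := hm.some
  have hzx : x ∈ cube z r := mem_cube_of_mem_netCube hz (mem_netCube_netIndex a hr x)
  set M := sharpMaximal s S α f x with hM
  have hPx : ∀ t, 0 < t → t ≤ 3 → (P x t).totalDegree ≤ ⌊α⌋₊ ∧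
      ⨍⁻ y in cube x t, ‖f y - polyEval (P x t) y‖ₑ ∂μ ≤ ENNReal.ofReal (t ^ α) * M := by
    refine fun t ht htR => ⟨hPdeg x hx t ht htR, le_trans ?_ (localApprox_le_sharpMaximal ht)⟩
    refine le_iInf₂ fun P' hP' => hPbest x hx t ht htR P' ?_
    rcases hP' with rfl | hP'
    · simp
    · exact Nat.lt_succ_iff.1 (hP'.trans_le (Nat.ceil_le_floor_add_one α))
  have h3r : 3 * r ≤ 3 := by linarith
  have hfx := hC₁ f hfm x hx hleb M (P x) hPx (3 * r) (by positivity) h3r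
  -- comparison of the two polynomials on the cube around `z`
  have hcmp : ‖polyEval (P x (3 * r)) x - polyEval (P z (2 * r)) x‖ₑ ≤
      2 * C₀ * K * (ENNReal.ofReal ((3 * r) ^ α) * M) := by
    have h1 := hC₀ z hzT (2 * r) (by positivity) (by linarith) (P x (3 * r) - P z (2 * r))
      ((MvPolynomial.totalDegree_sub _ _).trans (max_le (hPx _ (by positivity) h3r).1
        (hPdeg z hzT _ (by positivity) (by linarith)))) x (cube_mono z (by linarith) hzx)
    rw [polyEval_sub] at h1
    have h2 : ⨍⁻ y in cube z (2 * r), ‖polyEval (P x (3 * r) - P z (2 * r)) y‖ₑ ∂μ ≤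
        ⨍⁻ y in cube z (2 * r), ‖f y - polyEval (P x (3 * r)) y‖ₑ ∂μ +
        ⨍⁻ y in cube z (2 * r), ‖f y - polyEval (P z (2 * r)) y‖ₑ ∂μ := by
      refine setLAverage_add_le (measurableSet_cube _ _) (aemeasurable_enorm_sub_polyEval hfm _)
        fun y _ => ?_
      rw [polyEval_sub, enorm_sub_comm' (f y) (polyEval (P x (3 * r)) y)]
      exact enorm_sub_le_add _ _ _
    have h3 := hPbest z hzT (2 * r) (by positivity) (by linarith) _ (hPx _ (by positivity) h3r).1
    have h4 : ⨍⁻ y in cube z (2 * r), ‖f y - polyEval (P x (3 * r)) y‖ₑ ∂μ ≤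
        K * ⨍⁻ y in cube x (3 * r), ‖f y - polyEval (P x (3 * r)) y‖ₑ ∂μ := by
      refine setLAverage_le_of_subset (cube_subset_cube (mem_cube_comm.1 hzx) (by linarith))
        (h.measure_cube_pos hzT (by positivity)).ne' ?_ (h.finite _ _).ne _
      refine (measure_mono (cube_subset_cube hzx (u := 2 * (2 * r)) (by linarith))).trans ?_
      exact h.doubling z hzT _ (by positivity)
    calc _ ≤ _ := h1
      _ ≤ C₀ * (K * (ENNReal.ofReal ((3 * r) ^ α) * M) + K * (ENNReal.ofReal ((3 * r) ^ α) * M)) := by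
        have h5 := h4.trans (mul_le_mul' le_rfl (hPx _ (by positivity) h3r).2)
        gcongr
        exact h2.trans (add_le_add h5 (h3.trans h5))
      _ = _ := by ring
  have h3α : ENNReal.ofReal ((3 * r) ^ α) =
      ((3 ^ α : ℝ).toNNReal : ℝ≥0∞) * ENNReal.ofReal (r ^ α) := by
    rw [Real.mul_rpow (by norm_num) hr.le, ENNReal.ofReal_mul (by positivity)]; rfl
  calc _ ≤ _ := enorm_sub_le_add _ (polyEval (P x (3 * r)) x) _
    _ ≤ C₁ * ENNReal.ofReal ((3 * r) ^ α) * M + 2 * C₀ * K * (ENNReal.ofReal ((3 * r) ^ α) * M) :=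
      add_le_add hfx hcmp
    _ = _ := by rw [h3α]; push_cast; ring

/-- The embedding of the Calderón type space into `B^{p,∞}_α(S)`; a constant sequence is
admissible. -/
theorem exists_isBesovSequence (h : IsRegular (measureOn s S) T s 3 c₁ c₂ K) (hn : 1 ≤ n)
    (hs₀ : 0 < s) (hs : (n : ℝ) - 1 < s) {p : ℝ≥0∞} (hp : 1 ≤ p) {α : ℝ} (hα : 0 < α) :
    ∃ C : ℝ≥0, ∀ f ∈ CalderonSpace s S α p, ∃ c : ℕ → ℝ≥0, IsBesovSequence s S α p f c ∧
      lqNorm ∞ c ≤ C * eLpNorm (sharpMaximal s S α f) p (measureOn s S) := by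
  obtain ⟨C, hC⟩ := h.exists_piecewisePoly hn hs₀ hs hα
  have := h.isLocallyFiniteMeasure
  refine ⟨C, fun f hf => ?_⟩
  have hfin : eLpNorm (sharpMaximal s S α f) p (measureOn s S) ≠ ∞ :=
    (le_add_self.trans_lt hf.2).ne
  set N := (eLpNorm (sharpMaximal s S α f) p (measureOn s S)).toNNReal with hN
  have hN' : (N : ℝ≥0∞) = eLpNorm (sharpMaximal s S α f) p (measureOn s S) :=
    ENNReal.coe_toNNReal hfin
  refine ⟨fun _ => C * N, fun ν a => ?_, ?_⟩
  · have hr : (0 : ℝ) < 2 ^ (-(ν : ℝ)) := by positivity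
    have hr1 : (2 : ℝ) ^ (-(ν : ℝ)) ≤ 1 :=
      Real.rpow_le_one_of_one_le_of_nonpos (by norm_num) (by simp)
    obtain ⟨g, hg, hle⟩ := hC f (hf.1.locallyIntegrable hp) _ hr hr1 a
    refine ⟨g, hg, ?_⟩
    rw [← Real.rpow_mul (by norm_num), neg_mul] at hle
    have := eLpNorm_le_mul_eLpNorm_of_ae_le_mul' (f := fun y => f y - g y)
      (g := sharpMaximal s S α f) (c := C * ((2 : ℝ) ^ (-(ν * α))).toNNReal)
      (by simpa [ENNReal.ofReal] using hle) p
    refine this.trans_eq ?_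
    rw [← hN', ENNReal.ofReal]; push_cast; ring
  · rw [← hN', lqNorm, eLpNorm_exponent_top, eLpNormEssSup_const _ (by simp)]
    simp

end IsRegular

/-! ### Averaging operators and shifted nets -/

section Measurability

theorem measurableSet_mem_cube (t : ℝ) : MeasurableSet {z : Rn n × Rn n | z.2 ∈ cube z.1 t} := by
  have h0 : {z : Rn n × Rn n | z.2 ∈ cube z.1 t} = ⋂ i, {z | |z.2 i - z.1 i| ≤ t} := by
    ext z; simp [cube]
  rw [h0]
  refine (isClosed_iInter fun i => isClosed_le ?_ continuous_const).measurableSet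
  have h1 : Continuous fun z : Rn n × Rn n => z.1 i :=
    (EuclideanSpace.proj (𝕜 := ℝ) i).continuous.comp continuous_fst
  have h2 : Continuous fun z : Rn n × Rn n => z.2 i :=
    (EuclideanSpace.proj (𝕜 := ℝ) i).continuous.comp continuous_snd
  exact (h2.sub h1).abs

theorem measurable_setLIntegral_cube {μ : Measure (Rn n)} [SFinite μ] {u : Rn n → ℝ≥0∞}
    (hu : Measurable u) (t : ℝ) : Measurable fun x => ∫⁻ y in cube x t, u y ∂μ := by
  have h1 : ∀ x, ∫⁻ y in cube x t, u y ∂μ =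
      ∫⁻ y, {z : Rn n × Rn n | z.2 ∈ cube z.1 t}.indicator (fun z => u z.2) (x, y) ∂μ := by
    intro x
    rw [← lintegral_indicator (measurableSet_cube x t)]
    rfl
  simp only [h1]
  exact ((hu.comp measurable_snd).indicator (measurableSet_mem_cube t)).lintegral_prod_right'

theorem measurable_measure_cube {μ : Measure (Rn n)} [SFinite μ] (t : ℝ) :
    Measurable fun x => μ (cube x t) := by
  simpa using measurable_setLIntegral_cube (μ := μ) (u := fun _ => 1) measurable_const t

theorem aemeasurable_setLAverage_cube {μ : Measure (Rn n)} [SFinite μ] {u : Rn n → ℝ≥0∞}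
    (hu : AEMeasurable u μ) (t : ℝ) : AEMeasurable (fun x => ⨍⁻ y in cube x t, u y ∂μ) μ := by
  refine Measurable.aemeasurable ?_
  have h1 : ∀ x, ⨍⁻ y in cube x t, u y ∂μ =
      (∫⁻ y in cube x t, hu.mk u y ∂μ) / μ (cube x t) := fun x => by
    rw [setLAverage_eq, lintegral_congr_ae (ae_restrict_of_ae hu.ae_eq_mk)]
  simp only [h1]
  exact (measurable_setLIntegral_cube hu.measurable_mk t).div (measurable_measure_cube t)

theorem IsPiecewisePoly.measurable {d : ℕ} {a : Rn n} {r : ℝ} (hr : 0 < r) {g : Rn n → ℝ}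
    (hg : IsPiecewisePoly d a r g) : Measurable g := by
  choose P _ hP using hg
  have h1 : g = (fun z : (Fin n → ℤ) × Rn n => polyEval (P z.1) z.2) ∘
      fun y => (netIndex a r y, y) := by
    funext y
    exact hP _ y (mem_netCube_netIndex a hr y)
  rw [h1]
  refine (measurable_from_prod_countable_right fun m => (continuous_polyEval (P m)).measurable).comp
    (Measurable.prodMk ?_ measurable_id)
  refine measurable_pi_lambda _ fun i => Int.measurable_floor.comp ?_
  exact ((EuclideanSpace.proj (𝕜 := ℝ) i).continuous.measurable.sub_const _).div_const _

end Measurability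

namespace IsRegular

variable {μ : Measure (Rn n)} {T : Set (Rn n)} {s R c₁ c₂ : ℝ} {K : ℝ≥0}

/-- Averaging over cubes of a fixed size is bounded on `L^1`, by the doubling property and Tonelli's
theorem. -/
theorem lintegral_setLAverage_le (h : IsRegular μ T s R c₁ c₂ K) [SFinite μ] {v : Rn n → ℝ≥0∞}
    (hv : AEMeasurable v μ) {t : ℝ} (ht : 0 < t) :
    ∫⁻ x, ⨍⁻ y in cube x t, v y ∂μ ∂μ ≤ K * ∫⁻ y, v y ∂μ := by
  wlog hvm : Measurable v generalizing v
  · have h1 : ∀ x, ⨍⁻ y in cube x t, v y ∂μ = ⨍⁻ y in cube x t, hv.mk v y ∂μ := fun x => by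
      rw [setLAverage_eq, setLAverage_eq, lintegral_congr_ae (ae_restrict_of_ae hv.ae_eq_mk)]
    simp only [h1]
    rw [lintegral_congr_ae hv.ae_eq_mk]
    exact this hv.measurable_mk.aemeasurable hv.measurable_mk
  set w : Rn n → ℝ≥0∞ := fun y => K * v y / μ (cube y t) with hw
  have hwm : Measurable w := (hvm.const_mul _).div (measurable_measure_cube t)
  set k : Rn n → Rn n → ℝ≥0∞ := fun x y =>
    {z : Rn n × Rn n | z.2 ∈ cube z.1 t}.indicator (fun z => w z.2) (x, y) with hk
  have hkm : AEMeasurable (Function.uncurry k) (μ.prod μ) :=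
    ((hwm.comp measurable_snd).indicator (measurableSet_mem_cube t)).aemeasurable
  have h1 : ∀ᵐ x ∂μ, ⨍⁻ y in cube x t, v y ∂μ ≤ ∫⁻ y, k x y ∂μ := by
    filter_upwards [h.ae_mem] with x hx
    have hpos := h.measure_cube_pos hx ht
    have h2 : ∫⁻ y, k x y ∂μ = ∫⁻ y in cube x t, w y ∂μ := by
      rw [← lintegral_indicator (measurableSet_cube x t)]; rfl
    rw [h2, setLAverage_eq, div_eq_mul_inv, ← lintegral_mul_const _ hvm]
    refine lintegral_mono_ae ((ae_restrict_mem (measurableSet_cube x t)).mono fun y hy => ?_)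
    have h3 : μ (cube y t) ≤ K * μ (cube x t) :=
      (measure_mono (cube_subset_cube hy (by linarith))).trans (h.doubling x hx t ht)
    rw [hw, ← div_eq_mul_inv]
    calc v y / μ (cube x t) = K * v y / (K * μ (cube x t)) := by
          have hK : K ≠ 0 := by
            rintro rfl
            have := h.doubling x hx t ht
            have h4 := h.measure_cube_pos hx (show 0 < 2 * t by positivity)
            simp only [ENNReal.coe_zero, zero_mul] at this
            exact this.not_gt h4
          rw [ENNReal.mul_div_mul_left _ _ (by simpa using hK) (by simp)]
      _ ≤ _ := ENNReal.div_le_div_left h3 _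
  calc ∫⁻ x, ⨍⁻ y in cube x t, v y ∂μ ∂μ ≤ ∫⁻ x, ∫⁻ y, k x y ∂μ ∂μ := lintegral_mono_ae h1
    _ = ∫⁻ y, ∫⁻ x, k x y ∂μ ∂μ := lintegral_lintegral_swap hkm
    _ = ∫⁻ y, w y * μ (cube y t) ∂μ := by
      refine lintegral_congr fun y => ?_
      have h2 : ∀ x, k x y = (cube y t).indicator (fun _ => w y) x := fun x => by
        by_cases hxy : x ∈ cube y t
        · simp [hk, hxy, mem_cube_comm.1 hxy]
        · simp [hk, hxy, mt mem_cube_comm.1 hxy]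
      simp only [h2]
      rw [lintegral_indicator (measurableSet_cube y t), setLIntegral_const]
    _ ≤ ∫⁻ y, K * v y ∂μ := lintegral_mono fun y => by
      simp only [hw, div_eq_mul_inv, mul_assoc]
      gcongr
      exact mul_le_of_le_one_right' (ENNReal.inv_mul_le_one _)
    _ = _ := lintegral_const_mul _ hvm

/-- Averaging over cubes of a fixed size is bounded on `L^p`, uniformly in the size. -/
theorem eLpNorm_setLAverage_le (h : IsRegular μ T s R c₁ c₂ K) [SFinite μ] {p : ℝ≥0∞} (hp : 1 ≤ p)
    {u : Rn n → ℝ≥0∞} (hu : AEMeasurable u μ) {t : ℝ} (ht : 0 < t) :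
    eLpNorm (fun x => ⨍⁻ y in cube x t, u y ∂μ) p μ ≤ ((K + 1 : ℝ≥0) : ℝ≥0∞) * eLpNorm u p μ := by
  have hK1 : (1 : ℝ≥0∞) ≤ ((K + 1 : ℝ≥0) : ℝ≥0∞) := by push_cast; exact le_add_self
  by_cases hp' : p = ∞
  · subst hp'
    rw [eLpNorm_exponent_top, eLpNorm_exponent_top]
    refine le_trans ?_ (le_mul_of_one_le_left' hK1)
    refine essSup_le_of_ae_le _ (Eventually.of_forall fun x => ?_)
    refine le_trans ?_ (setLAverage_const_le (μ := μ) (cube x t) _)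
    simp only [enorm_eq_self, setLAverage_eq]
    refine ENNReal.div_le_div_right (lintegral_mono_ae (ae_restrict_of_ae ?_)) _
    filter_upwards [ae_le_eLpNormEssSup (f := u) (μ := μ)] with y hy
    simpa using hy
  have hp0 : p ≠ 0 := (zero_lt_one.trans_le hp).ne'
  have hpr : 1 ≤ p.toReal := by
    rw [← ENNReal.toReal_one]; exact ENNReal.toReal_mono hp' hp
  have hpr0 : 0 < p.toReal := by linarith
  rw [eLpNorm_eq_lintegral_rpow_enorm_toReal hp0 hp', eLpNorm_eq_lintegral_rpow_enorm_toReal hp0 hp']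
  simp only [enorm_eq_self]
  -- Jensen's inequality on each cube
  have hjensen : ∀ᵐ x ∂μ, (⨍⁻ y in cube x t, u y ∂μ) ^ p.toReal ≤
      ⨍⁻ y in cube x t, u y ^ p.toReal ∂μ := by
    filter_upwards [h.ae_mem] with x hx
    have hne : NeZero (μ.restrict (cube x t)) := ⟨by
      rw [Ne, Measure.restrict_eq_zero]; exact (h.measure_cube_pos hx ht).ne'⟩
    have hfin : IsFiniteMeasure (μ.restrict (cube x t)) := ⟨by
      rw [Measure.restrict_apply_univ]; exact h.finite x t⟩
    have := eLpNorm_le_eLpNorm_of_exponent_le hp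
      (μ := ((μ.restrict (cube x t)) univ)⁻¹ • μ.restrict (cube x t)) (f := u)
      (hu.restrict.smul_measure _).aestronglyMeasurable
    rw [eLpNorm_one_eq_lintegral_enorm, eLpNorm_eq_lintegral_rpow_enorm_toReal hp0 hp'] at this
    simp only [enorm_eq_self] at this
    calc (⨍⁻ y in cube x t, u y ∂μ) ^ p.toReal
        ≤ ((⨍⁻ y in cube x t, u y ^ p.toReal ∂μ) ^ (1 / p.toReal)) ^ p.toReal := by
          gcongr; exact this
      _ = _ := by rw [← ENNReal.rpow_mul, one_div_mul_cancel hpr0.ne', ENNReal.rpow_one]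
  calc _ ≤ (K * ∫⁻ y, u y ^ p.toReal ∂μ) ^ (1 / p.toReal) := by
        gcongr
        exact (lintegral_mono_ae hjensen).trans (h.lintegral_setLAverage_le (hu.pow_const _) ht)
    _ = (K : ℝ≥0∞) ^ (1 / p.toReal) * (∫⁻ y, u y ^ p.toReal ∂μ) ^ (1 / p.toReal) :=
      ENNReal.mul_rpow_of_nonneg _ _ (by positivity)
    _ ≤ _ := by
      gcongr
      calc (K : ℝ≥0∞) ^ (1 / p.toReal) ≤ ((K + 1 : ℝ≥0) : ℝ≥0∞) ^ (1 / p.toReal) := by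
            gcongr; exact le_self_add
        _ ≤ ((K + 1 : ℝ≥0) : ℝ≥0∞) ^ (1 : ℝ) :=
          ENNReal.rpow_le_rpow_of_exponent_le hK1 (by rw [div_le_one hpr0]; exact hpr)
        _ = _ := ENNReal.rpow_one _

theorem setLAverage_cube_le (h : IsRegular μ T s R c₁ c₂ K) {x : Rn n} (hx : x ∈ T) {t r : ℝ}
    (ht : 0 < t) (htr : t ≤ r) (hrt : r ≤ 2 * t) (u : Rn n → ℝ≥0∞) :
    ⨍⁻ y in cube x t, u y ∂μ ≤ K * ⨍⁻ y in cube x r, u y ∂μ :=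
  setLAverage_le_of_subset (cube_mono x htr) (h.measure_cube_pos hx ht).ne'
    ((measure_mono (cube_mono x hrt)).trans (h.doubling x hx t ht)) (h.finite _ _).ne u

end IsRegular

/-- The `L^p` norm of a supremum is bounded by the `ℓ^p` norm of the `L^p` norms. -/
theorem eLpNorm_iSup_le {μ : Measure (Rn n)} {p : ℝ≥0∞} (hp : p ≠ 0) {F : ℕ → Rn n → ℝ≥0∞}
    (hF : ∀ j, AEMeasurable (F j) μ) {c : ℕ → ℝ≥0} {D : ℝ≥0}
    (hc : ∀ j, eLpNorm (F j) p μ ≤ D * c j) :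
    eLpNorm (fun x => ⨆ j, F j x) p μ ≤ D * lqNorm p c := by
  by_cases hp' : p = ∞
  · subst hp'
    rw [eLpNorm_exponent_top]
    refine essSup_le_of_ae_le _ ?_
    have h1 : ∀ᵐ x ∂μ, ∀ j, F j x ≤ D * c j := by
      rw [ae_all_iff]
      intro j
      filter_upwards [ae_le_eLpNormEssSup (f := F j) (μ := μ)] with x hx
      rw [enorm_eq_self] at hx
      exact hx.trans (by rw [← eLpNorm_exponent_top]; exact hc j)
    filter_upwards [h1] with x hx
    rw [enorm_eq_self]
    refine iSup_le fun j => (hx j).trans ?_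
    gcongr
    have := enorm_le_eLpNorm_count (p := ∞) (fun ν => (c ν : ℝ)) j (by simp)
    simpa [lqNorm] using this
  have hpr : 0 < p.toReal := ENNReal.toReal_pos hp hp'
  have hFp : ∀ j, ∫⁻ x, F j x ^ p.toReal ∂μ ≤ (D * c j : ℝ≥0∞) ^ p.toReal := by
    intro j
    have := hc j
    rw [eLpNorm_eq_lintegral_rpow_enorm_toReal hp hp', one_div, ENNReal.rpow_inv_le_iff hpr] at this
    simpa using this
  rw [lqNorm, eLpNorm_eq_lintegral_rpow_enorm_toReal hp hp',
    eLpNorm_eq_lintegral_rpow_enorm_toReal hp hp', lintegral_count]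
  calc _ ≤ (∑' j, (D * c j : ℝ≥0∞) ^ p.toReal) ^ (1 / p.toReal) := by
        gcongr
        calc _ ≤ ∫⁻ x, ∑' j, F j x ^ p.toReal ∂μ := by
              refine lintegral_mono fun x => ?_
              rw [enorm_eq_self, ← ENNReal.le_rpow_inv_iff hpr]
              refine iSup_le fun j => ?_
              rw [ENNReal.le_rpow_inv_iff hpr]
              exact ENNReal.le_tsum j
          _ = ∑' j, ∫⁻ x, F j x ^ p.toReal ∂μ := lintegral_tsum fun j => (hF j).pow_const _
          _ ≤ _ := ENNReal.tsum_le_tsum hFp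
    _ = _ := by
      simp only [ENNReal.mul_rpow_of_nonneg _ _ hpr.le]
      rw [ENNReal.tsum_mul_left, ENNReal.mul_rpow_of_nonneg _ _ (by positivity), ← ENNReal.rpow_mul,
        mul_one_div_cancel hpr.ne', ENNReal.rpow_one]
      simp

theorem lqNorm_geometric_lt_top {p : ℝ≥0∞} (hp : p ≠ 0) {q : ℝ≥0} (hq : q < 1) :
    lqNorm p (fun j => q ^ j) < ∞ := by
  by_cases hp' : p = ∞
  · subst hp'
    rw [lqNorm, eLpNorm_exponent_top]
    refine (essSup_le_of_ae_le 1 (Eventually.of_forall fun j => ?_)).trans_lt ENNReal.one_lt_top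
    rw [← ofReal_norm, ← ENNReal.ofReal_one]
    apply ENNReal.ofReal_le_ofReal
    rw [Real.norm_of_nonneg (by positivity)]
    exact_mod_cast pow_le_one₀ (zero_le (a := q)) hq.le
  have hpr : 0 < p.toReal := ENNReal.toReal_pos hp hp'
  rw [lqNorm, eLpNorm_eq_lintegral_rpow_enorm_toReal hp hp', lintegral_count]
  refine ENNReal.rpow_lt_top_of_nonneg (by positivity) (ne_of_lt ?_)
  have h1 : ∀ j : ℕ, ‖((q ^ j : ℝ≥0) : ℝ)‖ₑ ^ p.toReal = ((q : ℝ≥0∞) ^ p.toReal) ^ j := by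
    intro j
    have : ‖((q ^ j : ℝ≥0) : ℝ)‖ₑ = (q : ℝ≥0∞) ^ j := by simp
    rw [this, ← ENNReal.rpow_natCast, ← ENNReal.rpow_natCast, ← ENNReal.rpow_mul,
      ← ENNReal.rpow_mul, mul_comm]
  simp only [h1]
  rw [ENNReal.tsum_geometric, ENNReal.inv_lt_top, tsub_pos_iff_lt]
  exact ENNReal.rpow_lt_one (by exact_mod_cast hq) hpr

/-- The base points of `2 ^ n` nets of mesh size `4 h`, shifted against each other by `2 h` in some of
the coordinates. -/
noncomputable def shift (h : ℝ) (b : Fin n → Bool) : Rn n :=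
  WithLp.toLp 2 fun i => if b i then 2 * h else 0

/-- Every cube `Q(x, h)` lies in a cube of one of the shifted nets of mesh size `4 h`. -/
theorem exists_cube_subset_netCube {h : ℝ} (hh : 0 < h) (x : Rn n) :
    ∃ (b : Fin n → Bool) (m : Fin n → ℤ), cube x h ⊆ netCube (shift h b) (4 * h) m := by
  have hex : ∀ i, ∃ (b : Bool) (m : ℤ), (if b then 2 * h else 0) + 4 * h * m ≤ x i - h ∧
      x i + h < (if b then 2 * h else 0) + 4 * h * (m + 1) := by
    intro i
    have h1 := Int.floor_le ((x i - h) / (2 * h))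
    have h2 := Int.lt_floor_add_one ((x i - h) / (2 * h))
    rw [le_div_iff₀ (by positivity)] at h1
    rw [div_lt_iff₀ (by positivity)] at h2
    rcases Int.even_or_odd' ⌊(x i - h) / (2 * h)⌋ with ⟨m, hm | hm⟩
    · refine ⟨false, m, ?_⟩
      rw [hm] at h1 h2
      push_cast at h1 h2
      constructor <;> simp only [Bool.false_eq_true, if_false] <;> linarith
    · refine ⟨true, m, ?_⟩
      rw [hm] at h1 h2
      push_cast at h1 h2
      constructor <;> simp only [if_true] <;> linarith
  choose b m hb using hex
  refine ⟨b, m, fun y hy i => ?_⟩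
  have h1 := abs_le.1 (hy i)
  have h2 := hb i
  simp only [shift]
  constructor <;> linarith

/-! ### The sharp maximal function of a Besov function -/

theorem IsRegular.eLpNorm_setLAverage_enorm_le {μ : Measure (Rn n)} {T : Set (Rn n)}
    {s R c₁ c₂ : ℝ} {K : ℝ≥0} (h : IsRegular μ T s R c₁ c₂ K) [SFinite μ] {p : ℝ≥0∞} (hp : 1 ≤ p)
    {f : Rn n → ℝ} (hf : AEMeasurable f μ) {t : ℝ} (ht : 0 < t) :
    eLpNorm (fun x => ⨍⁻ y in cube x t, ‖f y‖ₑ ∂μ) p μ ≤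
      ((K + 1 : ℝ≥0) : ℝ≥0∞) * eLpNorm f p μ := by
  refine (h.eLpNorm_setLAverage_le hp hf.enorm ht).trans_eq ?_
  congr 1

/-- The embedding of `B^{p,p}_α(S)` into the Calderón type space. At scales below `1 / 4`, the local
approximation on `Q(x, t)` is bounded by the average of `|f - g|` over a comparable cube, where `g`
is admissible for one of the `2 ^ n` shifted nets, one cube of which contains that cube. At larger
scales, the approximation by zero suffices. The dyadic scales are summed in `ℓ^p`. -/
theorem IsRegular.exists_eLpNorm_sharpMaximal_le {T : Set (Rn n)} {s R c₁ c₂ : ℝ} {K : ℝ≥0}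
    {S : Set (Rn n)} (h : IsRegular (measureOn s S) T s R c₁ c₂ K) {p : ℝ≥0∞} (hp : 1 ≤ p)
    {α : ℝ} (hα : 0 < α) (hα' : ∀ m : ℤ, α ≠ m) :
    ∃ C : ℝ≥0, ∀ f, MemLp f p (measureOn s S) → ∀ c : ℕ → ℝ≥0, IsBesovSequence s S α p f c →
      eLpNorm (sharpMaximal s S α f) p (measureOn s S) ≤
        C * (eLpNorm f p (measureOn s S) + lqNorm p c) := by
  set μ := measureOn s S
  have := h.isLocallyFiniteMeasure
  have hp0 : p ≠ 0 := (zero_lt_one.trans_le hp).ne'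
  set q : ℝ≥0 := (1 / 2 : ℝ≥0) ^ α with hq
  have hq1 : q < 1 := NNReal.rpow_lt_one (by rw [one_div]; exact inv_lt_one_of_one_lt₀ (by norm_num)) hα
  set B : ℝ≥0 := (lqNorm p fun j => q ^ j).toNNReal with hB
  have hB' : (B : ℝ≥0∞) = lqNorm p fun j => q ^ j :=
    ENNReal.coe_toNNReal (lqNorm_geometric_lt_top hp0 hq1).ne
  set e8 : ℝ≥0 := ((8 : ℝ) ^ α).toNNReal
  set e4 : ℝ≥0 := ((4 : ℝ) ^ α).toNNReal
  set D₁ : ℝ≥0 := K * e8 * (2 ^ n * (K + 1)) with hD₁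
  set D₂ : ℝ≥0 := K * e4 * (K + 1) * B with hD₂
  refine ⟨D₁ + D₂, fun f hf c hc => ?_⟩
  have hfm : AEMeasurable f μ := hf.1.aemeasurable
  -- the admissible piecewise polynomials on the shifted dyadic nets
  set r : ℕ → ℝ := fun k => (2 : ℝ) ^ (-(k : ℝ)) with hr
  have hr0 : ∀ k, 0 < r k := fun k => by positivity
  have hrpow : ∀ k, r k = (1 / 2) ^ k := fun k => by
    simp only [hr]; rw [Real.rpow_neg (by norm_num), Real.rpow_natCast, one_div, inv_pow]
  have hrα : ∀ k : ℕ, (2 : ℝ) ^ (-(k * α)) = r k ^ α := fun k => by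
    simp only [hr]; rw [← Real.rpow_mul (by norm_num), neg_mul]
  choose g hgpoly hgle using fun (k : ℕ) (b : Fin n → Bool) => hc k (shift (r k / 4) b)
  have hgm : ∀ k b, AEMeasurable (fun y => f y - g k b y) μ := fun k b =>
    hfm.sub ((hgpoly k b).measurable (hr0 k)).aemeasurable
  set w : ℕ → ℝ≥0 := fun k => (r k ^ (-α)).toNNReal with hw
  have hwr : ∀ k, (w k : ℝ≥0∞) * ENNReal.ofReal (r k ^ α) = 1 := fun k => by
    change ENNReal.ofReal (r k ^ (-α)) * _ = 1
    have := hr0 k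
    rw [← ENNReal.ofReal_mul (by positivity), ← Real.rpow_add this, neg_add_cancel, Real.rpow_zero,
      ENNReal.ofReal_one]
  -- small scales
  set A : ℕ → (Fin n → Bool) → Rn n → ℝ≥0∞ := fun k b x =>
    ⨍⁻ y in cube x (r k / 4), ‖f y - g k b y‖ₑ ∂μ with hA
  have hAm : ∀ k b, AEMeasurable (A k b) μ := fun k b =>
    aemeasurable_setLAverage_cube (hgm k b).enorm _
  set F : ℕ → Rn n → ℝ≥0∞ := fun k x => ((K * e8 * w k : ℝ≥0) : ℝ≥0∞) * ∑ b, A k b x with hF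
  have hFm : ∀ k, AEMeasurable (F k) μ := fun k =>
    (Finset.aemeasurable_fun_sum _ fun b _ => hAm k b).const_mul _
  have hFle : ∀ k, eLpNorm (F k) p μ ≤ D₁ * c k := by
    intro k
    have h1 : eLpNorm (F k) p μ ≤
        ((K * e8 * w k : ℝ≥0) : ℝ≥0∞) * eLpNorm (fun x => ∑ b, A k b x) p μ :=
      eLpNorm_le_mul_eLpNorm_of_ae_le_mul' (Eventually.of_forall fun x => by simp [hF]) p
    have h2 : eLpNorm (fun x => ∑ b, A k b x) p μ ≤ ∑ b, eLpNorm (A k b) p μ := by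
      have hsum : (fun x => ∑ b, A k b x) = ∑ b, A k b := by funext x; simp
      rw [hsum]
      exact eLpNorm_sum_le (fun b _ => (hAm k b).aestronglyMeasurable) hp
    have h3 : ∀ b, eLpNorm (A k b) p μ ≤
        ((K + 1 : ℝ≥0) : ℝ≥0∞) * (ENNReal.ofReal (r k ^ α) * c k) := fun b => by
      refine (h.eLpNorm_setLAverage_enorm_le hp (hgm k b) (by have := hr0 k; positivity)).trans ?_
      gcongr
      rw [← hrα]
      have := hgle k b
      exact this
    calc _ ≤ _ := h1
      _ ≤ ((K * e8 * w k : ℝ≥0) : ℝ≥0∞) *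
          ∑ _b : Fin n → Bool, ((K + 1 : ℝ≥0) : ℝ≥0∞) * (ENNReal.ofReal (r k ^ α) * c k) := by
        gcongr
        exact h2.trans (Finset.sum_le_sum fun b _ => h3 b)
      _ = (w k * ENNReal.ofReal (r k ^ α)) * (D₁ * c k) := by
        rw [Finset.sum_const, nsmul_eq_mul]
        simp only [Finset.card_univ, Fintype.card_pi, Fintype.card_bool, Finset.prod_const,
          Fintype.card_fin, hD₁]
        push_cast
        ring
      _ = _ := by rw [hwr, one_mul]
  -- large scales
  set N : ℝ≥0 := (eLpNorm f p μ).toNNReal with hN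
  have hN' : (N : ℝ≥0∞) = eLpNorm f p μ := ENNReal.coe_toNNReal hf.2.ne
  set G : ℕ → Rn n → ℝ≥0∞ := fun j x =>
    ((K * e4 * q ^ j : ℝ≥0) : ℝ≥0∞) * ⨍⁻ y in cube x (2 ^ (j + 1) / 4), ‖f y‖ₑ ∂μ with hG
  have hGm : ∀ j, AEMeasurable (G j) μ := fun j =>
    (aemeasurable_setLAverage_cube hfm.enorm _).const_mul _
  have hGle : ∀ j, eLpNorm (G j) p μ ≤ ((K * e4 * (K + 1) * N : ℝ≥0) : ℝ≥0∞) * (q ^ j : ℝ≥0) := by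
    intro j
    calc eLpNorm (G j) p μ ≤ ((K * e4 * q ^ j : ℝ≥0) : ℝ≥0∞) *
          eLpNorm (fun x => ⨍⁻ y in cube x (2 ^ (j + 1) / 4), ‖f y‖ₑ ∂μ) p μ :=
          eLpNorm_le_mul_eLpNorm_of_ae_le_mul' (Eventually.of_forall fun x => by simp [hG]) p
      _ ≤ ((K * e4 * q ^ j : ℝ≥0) : ℝ≥0∞) * (((K + 1 : ℝ≥0) : ℝ≥0∞) * N) := by
        gcongr
        rw [hN']
        exact h.eLpNorm_setLAverage_enorm_le hp hfm (by positivity)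
      _ = _ := by push_cast; ring
  -- the pointwise bound
  have hpt : ∀ᵐ x ∂μ, sharpMaximal s S α f x ≤ (⨆ k, F k x) + ⨆ j, G j x := by
    filter_upwards [h.ae_mem] with x hx
    refine iSup₂_le fun t ht => ?_
    rcases le_or_gt (4 * t) 1 with ht1 | ht1
    · refine le_add_right ?_
      obtain ⟨k, hk1, hk2⟩ := exists_nat_pow_near_of_lt_one (x := 4 * t) (y := (1 / 2 : ℝ))
        (by positivity) ht1 (by norm_num) (by norm_num)
      rw [pow_succ, ← hrpow] at hk1
      rw [← hrpow] at hk2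
      have hrk := hr0 k
      refine le_trans ?_ (le_iSup (fun k => F k x) k)
      obtain ⟨b, m, hbm⟩ := exists_cube_subset_netCube (h := r k / 4) (by positivity) x
      rw [show 4 * (r k / 4) = r k by ring] at hbm
      obtain ⟨P, hPdeg, hP⟩ := hgpoly k b m
      have h1 : localApprox s S ⌈α⌉₊ f (cube x t) ≤ K * ∑ b, A k b x := by
        calc _ ≤ ⨍⁻ y in cube x t, ‖f y - polyEval P y‖ₑ ∂μ :=
              localApprox_le_of_totalDegree hα.le hα' hPdeg
          _ ≤ K * ⨍⁻ y in cube x (r k / 4), ‖f y - polyEval P y‖ₑ ∂μ :=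
            h.setLAverage_cube_le hx ht (by linarith) (by linarith) _
          _ ≤ K * A k b x := by
            gcongr
            refine setLAverage_mono (measurableSet_cube _ _) fun y hy => ?_
            rw [hP y (hbm hy)]
          _ ≤ _ := by
            gcongr
            exact Finset.single_le_sum (f := fun b => A k b x) (fun _ _ => bot_le)
              (Finset.mem_univ b)
      have h2 : ENNReal.ofReal (t ^ (-α)) ≤ (e8 * w k : ℝ≥0∞) := by
        change _ ≤ ENNReal.ofReal _ * ENNReal.ofReal _
        rw [← ENNReal.ofReal_mul (by positivity)]
        apply ENNReal.ofReal_le_ofReal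
        calc t ^ (-α) ≤ (r k / 8) ^ (-α) :=
              Real.rpow_le_rpow_of_nonpos (by positivity) (by linarith) (by linarith)
          _ = _ := by
            rw [Real.div_rpow hrk.le (by norm_num), Real.rpow_neg (x := 8) (by norm_num)]
            field_simp
      calc _ ≤ (e8 * w k : ℝ≥0∞) * (K * ∑ b, A k b x) := mul_le_mul' h2 h1
        _ = F k x := by simp only [hF]; push_cast; ring
    · refine le_add_left ?_
      obtain ⟨j, hj1, hj2⟩ := exists_nat_pow_near ht1.le (one_lt_two (α := ℝ))
      refine le_trans ?_ (le_iSup (fun j => G j x) j)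
      have h1 : localApprox s S ⌈α⌉₊ f (cube x t) ≤
          K * ⨍⁻ y in cube x (2 ^ (j + 1) / 4), ‖f y‖ₑ ∂μ := by
        calc _ ≤ ⨍⁻ y in cube x t, ‖f y - polyEval 0 y‖ₑ ∂μ :=
              localApprox_le_of_totalDegree hα.le hα' (by simp)
          _ = ⨍⁻ y in cube x t, ‖f y‖ₑ ∂μ := by simp only [polyEval_zero, sub_zero]
          _ ≤ _ := h.setLAverage_cube_le hx ht (by linarith)
            (by rw [pow_succ]; linarith) _
      have h2 : ENNReal.ofReal (t ^ (-α)) ≤ (e4 * (q ^ j : ℝ≥0) : ℝ≥0∞) := by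
        have hqj : ((q ^ j : ℝ≥0) : ℝ≥0∞) = ENNReal.ofReal (((2 : ℝ) ^ j) ^ (-α)) := by
          rw [← ENNReal.ofReal_coe_nnreal]
          congr 1
          rw [hq]
          push_cast
          rw [Real.rpow_neg (by positivity), Real.rpow_pow_comm (by positivity), one_div, inv_pow,
            Real.inv_rpow (by positivity)]
        rw [hqj]
        change _ ≤ ENNReal.ofReal _ * ENNReal.ofReal _
        rw [← ENNReal.ofReal_mul (by positivity)]
        apply ENNReal.ofReal_le_ofReal
        calc t ^ (-α) ≤ ((2 : ℝ) ^ j / 4) ^ (-α) :=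
              Real.rpow_le_rpow_of_nonpos (by positivity) (by linarith) (by linarith)
          _ = _ := by
            rw [Real.div_rpow (by positivity) (by norm_num), Real.rpow_neg (x := 4) (by norm_num)]
            field_simp
      calc _ ≤ (e4 * (q ^ j : ℝ≥0) : ℝ≥0∞) *
            (K * ⨍⁻ y in cube x (2 ^ (j + 1) / 4), ‖f y‖ₑ ∂μ) := mul_le_mul' h2 h1
        _ = G j x := by simp only [hG]; push_cast; ring
  calc eLpNorm (sharpMaximal s S α f) p μ
      ≤ eLpNorm (fun x => (⨆ k, F k x) + ⨆ j, G j x) p μ :=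
        eLpNorm_mono_enorm_ae (by simpa using hpt)
    _ ≤ eLpNorm (fun x => ⨆ k, F k x) p μ + eLpNorm (fun x => ⨆ j, G j x) p μ :=
      eLpNorm_add_le (AEMeasurable.iSup hFm).aestronglyMeasurable
        (AEMeasurable.iSup hGm).aestronglyMeasurable hp
    _ ≤ D₁ * lqNorm p c + ((K * e4 * (K + 1) * N : ℝ≥0) : ℝ≥0∞) * lqNorm p fun j => q ^ j :=
      add_le_add (eLpNorm_iSup_le hp0 hFm hFle) (eLpNorm_iSup_le hp0 hGm hGle)
    _ = D₁ * lqNorm p c + D₂ * eLpNorm f p μ := by rw [← hB', ← hN', hD₂]; push_cast; ring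
    _ ≤ (D₁ + D₂ : ℝ≥0) * lqNorm p c + (D₁ + D₂ : ℝ≥0) * eLpNorm f p μ := by
      gcongr
      · exact le_self_add
      · exact le_add_self
    _ = _ := by ring

end SSet

theorem theorem4p1 (n : ℕ) (hn : 1 ≤ n) (s : ℝ) (hs₁ : (n : ℝ) - 1 < s) (hs₂ : s ≤ n)
    (S : Set (SSet.Rn n)) (hS : SSet.IsSSet s S)
    (p : ℝ≥0∞) (hp : 1 < p)
    (α : ℝ) (hα : 0 < α) (hα' : ∀ m : ℤ, α ≠ m) :
    (SSet.BesovSpace s S α p p ⊆ SSet.CalderonSpace s S α p ∧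
      SSet.CalderonSpace s S α p ⊆ SSet.BesovSpace s S α p ∞) ∧
    ∃ C : ℝ≥0,
      (∀ f ∈ SSet.BesovSpace s S α p p,
        SSet.calderonNorm s S α p f ≤ C * SSet.besovNorm s S α p p f) ∧
      (∀ f ∈ SSet.CalderonSpace s S α p,
        SSet.besovNorm s S α p ∞ f ≤ C * SSet.calderonNorm s S α p f) := by
  have hs₀ : 0 < s := by
    have : (1 : ℝ) ≤ n := by exact_mod_cast hn
    linarith
  obtain ⟨T, c₁, c₂, K, h⟩ := hS.exists_isRegular hs₀ (R := 3) (by norm_num)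
  obtain ⟨C, hC⟩ := h.exists_isBesovSequence hn hs₀ hs₁ hp.le hα
  obtain ⟨D, hD⟩ := h.exists_eLpNorm_sharpMaximal_le hp.le hα hα'
  refine ⟨⟨?_, ?_⟩, 1 + C + D, ?_, ?_⟩
  · rintro f ⟨hf, c, hc, hadm⟩
    refine ⟨hf, ENNReal.add_lt_top.2 ⟨hf.2, (hD f hf c hadm).trans_lt ?_⟩⟩
    exact ENNReal.mul_lt_top ENNReal.coe_lt_top (ENNReal.add_lt_top.2 ⟨hf.2, hc⟩)
  · intro f hf
    obtain ⟨c, hadm, hc⟩ := hC f hf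
    refine ⟨hf.1, c, hc.trans_lt ?_, hadm⟩
    exact ENNReal.mul_lt_top ENNReal.coe_lt_top (le_add_self.trans_lt hf.2)
  · rintro f ⟨hf, -⟩
    have h0 : ((1 + C + D : ℝ≥0) : ℝ≥0∞) ≠ 0 := by
      simp
    -- pass to the infimum over all admissible sequences
    rw [SSet.besovNorm, ← ENNReal.div_le_iff' h0 ENNReal.coe_ne_top, ← tsub_le_iff_left]
    refine le_iInf₂ fun c hadm => ?_
    rw [tsub_le_iff_left, ENNReal.div_le_iff' h0 ENNReal.coe_ne_top, SSet.calderonNorm]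
    calc _ ≤ eLpNorm f p (SSet.measureOn s S) +
          D * (eLpNorm f p (SSet.measureOn s S) + SSet.lqNorm p c) := by
          gcongr; exact hD f hf c hadm
      _ ≤ (eLpNorm f p (SSet.measureOn s S) + SSet.lqNorm p c) +
          C * (eLpNorm f p (SSet.measureOn s S) + SSet.lqNorm p c) +
          D * (eLpNorm f p (SSet.measureOn s S) + SSet.lqNorm p c) := by
          gcongr
          rw [add_assoc]; exact le_self_add
      _ = _ := by push_cast; ring
  · intro f hf
    obtain ⟨c, hadm, hc⟩ := hC f hf
    rw [SSet.besovNorm, SSet.calderonNorm]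
    calc _ ≤ eLpNorm f p (SSet.measureOn s S) +
          C * eLpNorm (SSet.sharpMaximal s S α f) p (SSet.measureOn s S) := by
          gcongr; exact (iInf₂_le c hadm).trans hc
      _ ≤ (1 + C + D) * eLpNorm f p (SSet.measureOn s S) +
          (1 + C + D) * eLpNorm (SSet.sharpMaximal s S α f) p (SSet.measureOn s S) := by
          gcongr
          · rw [add_assoc]; exact le_mul_of_one_le_left' le_self_add
          · rw [add_assoc, add_left_comm]; exact le_self_add
      _ = _ := by push_cast; ring
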